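/- Let $k\ge 0$ be an integer and let $\mathfrak g,\mathfrak g'\subset \mathrm{End}(\mathbb C^k)$ be complex semisimple Lie subalgebras (for the commutator bracket). Suppose that $\mathfrak t\subset \mathrm{End}(\mathbb C^k)$ is a common Cartan subalgebra of $\mathfrak g$ and $\mathfrak g'$ (so that the two tautological representations on $\mathbb C^k$ have the same formal character, namely the multiset of weights of $\mathfrak t$ on $\mathbb C^k$). Let $\{\mathfrak q_i\}_i$ and $\{\mathfrak q'_j\}_j$ be the families of simple factors (simple ideals) of $\mathfrak g$ and of $\mathfrak g'$. Let $R_i\subset\mathfrak t^*$ be the set of roots of $\mathfrak q_i$ with respect to $\mathfrak t\cap \mathfrak q_i$, viewed in $\mathfrak t^*$ by extending them by zero on $\mathfrak t\cap\mathfrak q_{l}$ for $l\neq i$; that is, $R_i$ is the set of nonzero $\alpha\in\mathfrak t^*$ for which there is a nonzero $x\in\mathfrak q_i$ with $[h,x]=\alpha(h)x$ for all $h\in\mathfrak t$. Define $R'_j\subset\mathfrak t^*$ in the same way from $\mathfrak q'_j$. Assume that 1. every simple factor $\mathfrak q_i$ of $\mathfrak g$ is of type $A_n$, i.e. isomorphic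 to $\mathfrak{sl}_{n+1}(\mathbb C)$, for some $n\in\mathbb N\setminus\{1,2,3,5,7,8\}$; 2. $\mathfrak g$ has at most one simple factor of type $A_4$. Then $\mathfrak g\cong\mathfrak g'$ as complex Lie algebras. Moreover, there is a bijection $\mathfrak q_i\leftrightarrow\mathfrak q'_i$ between the simple factors of $\mathfrak g$ and those of $\mathfrak g'$ such that, for every $i$, (i) $\mathfrak q_i\cong\mathfrak q'_i$ as complex Lie algebras; (ii) $R_i=R'_i$ as subsets of $\mathfrak t^*$ (hence as subsets of the weight space, the real span of the weights in $\mathfrak t^*$). -/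

import Mathlib

-- The commutator bracket on an associative algebra.
attribute [local instance 100] LieRing.ofAssociativeRing

/-- A simple factor of a complex Lie algebra `L`: an ideal of `L` which is a simple Lie algebra.
A semisimple `L` is the internal direct sum of its simple factors. -/
abbrev SimpleFactor (L : Type*) [LieRing L] [LieAlgebra ℂ L] : Type _ :=
  {q : LieIdeal ℂ L // LieAlgebra.IsSimple ℂ q}

/-- `L` is of type `A_n`, i.e. isomorphic to `sl_{n+1}` over the complex numbers. -/
def IsOfTypeA (n : ℕ) (L : Type*) [LieRing L] [LieAlgebra ℂ L] : Prop :=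
  Nonempty (L ≃ₗ⁅ℂ⁆ LieAlgebra.SpecialLinear.sl (Fin (n + 1)) ℂ)

/-- `t` is a Cartan subalgebra of the Lie subalgebra `g` of an ambient Lie algebra `M`. -/
def IsCartanIn {M : Type*} [LieRing M] [LieAlgebra ℂ M] (t g : LieSubalgebra ℂ M) : Prop :=
  t ≤ g ∧ (t.comap g.incl).IsCartanSubalgebra

/-- The roots of an ideal `q` of `g` with respect to `t`, as a subset of the dual of `t`: the
nonzero functionals `α` on `t` for which some nonzero `x ∈ q` satisfies `⁅h, x⁆ = α h • x` for all
`h ∈ t`. For `t` a Cartan subalgebra of a semisimple `g` and `q` a simple factor, such an `α`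
vanishes on the part of `t` in the other simple factors, so these are the roots of `q` with respect
to `t ∩ q`, viewed in the dual of `t` via `t = ⨁ i, t ∩ q i`. -/
def rootsOf {M : Type*} [LieRing M] [LieAlgebra ℂ M] (t : LieSubalgebra ℂ M)
    {g : LieSubalgebra ℂ M} (q : LieIdeal ℂ g) : Set (Module.Dual ℂ t) :=
  {α | α ≠ 0 ∧ ∃ x : g, x ∈ q ∧ x ≠ 0 ∧ ∀ h : t, ⁅(h : M), (x : M)⁆ = α h • (x : M)}

/-! The trace form of ℂ^k, restricted to `t`, sees both algebras at once. If (H, e, f) is an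
sl₂-triple with H in `t` and e of weight α, invariance gives 2 tr(hH) = α(h) tr(H²) for h in `t`,
whichever algebra contains e and f. The form is positive on elements with integral weights, so
Cauchy–Schwarz applies. Hence a root of `g'` and a root of `g`, paired with each other's coroots,
give two integers whose product is less than 4, unless the roots are proportional
(`IsSl2Triple.exists_pairing`).

Identify `g` with a product of sl_m, m = n_i + 1, so that `t` becomes diagonal. For a root α of `g'`
with coroot H, expanding H in diagonal coordinates writes 2 = α(H) as a sum over the factors. If α
is proportional to no root of `g`, integrality makes the coordinates of H in each factor take at
most two values, and the factor contributes N j (m - j) / m with 1 ≤ N ≤ 3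
(`SLCoords.exists_contribution`). The hypotheses leave m = 5, at most once, and m ≥ 7; such numbers
never add up to 2 (`sum_mul_mul_sub_div_ne_two`). So α is a multiple of a root of `g`, and
integrality makes the multiple ±1 (`SLCoords.exists_eq_sub`).

Conversely the roots of `g'` span the dual of `t`, so they connect all indices of each factor, and
every root of `g` is a root of `g'` (`RootsLE.mem_rootSet`). Roots and coroots now agree, and matrix
units built inside `g'` extend the identity of `t` to an isomorphism (`RootsLE.exists_lieEquiv`),
which matches simple factors together with their roots. -/

open LieAlgebra LieModule

/-! ### Weight vectors and roots inside the ambient Lie algebra. -/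

section WeightVectors

variable {M : Type*} [LieRing M] [LieAlgebra ℂ M]

/-- The simultaneous eigenspace of a Lie subalgebra `t` on the ambient Lie algebra. -/
def weightVectors (t : LieSubalgebra ℂ M) (α : Module.Dual ℂ t) : Submodule ℂ M where
  carrier := {x | ∀ h : t, ⁅(h : M), x⁆ = α h • x}
  add_mem' {x y} hx hy h := by rw [lie_add, hx h, hy h, smul_add]
  zero_mem' h := by simp
  smul_mem' c x hx h := by rw [lie_smul, hx h, smul_comm]

lemma lie_mem_weightVectors {t : LieSubalgebra ℂ M} {α β : Module.Dual ℂ t} {x y : M}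
    (hx : x ∈ weightVectors t α) (hy : y ∈ weightVectors t β) :
    ⁅x, y⁆ ∈ weightVectors t (α + β) := fun h => by
  rw [leibniz_lie, hx h, hy h, smul_lie, lie_smul, LinearMap.add_apply, add_smul]

/-- The roots of a Lie subalgebra `g` with respect to `t`. -/
def rootSet (t g : LieSubalgebra ℂ M) : Set (Module.Dual ℂ t) :=
  {α | α ≠ 0 ∧ ∃ x ∈ g, x ≠ 0 ∧ x ∈ weightVectors t α}

lemma lie_eq_zero_of_notMem_rootSet {t g : LieSubalgebra ℂ M} {α β : Module.Dual ℂ t} {x y : M}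
    (hxg : x ∈ g) (hyg : y ∈ g)
    (hx : x ∈ weightVectors t α) (hy : y ∈ weightVectors t β) (h0 : α + β ≠ 0)
    (hr : α + β ∉ rootSet t g) : ⁅x, y⁆ = 0 := by
  by_contra h
  exact hr ⟨h0, _, g.lie_mem hxg hyg, h, lie_mem_weightVectors hx hy⟩

end WeightVectors

/-! ### Root space theory of a semisimple subalgebra, seen from the ambient algebra. -/

section Cartan

variable {M : Type*} [LieRing M] [LieAlgebra ℂ M] [FiniteDimensional ℂ M]
  {t g : LieSubalgebra ℂ M}

/-- A Cartan subalgebra of `g`, regarded inside `g` or inside the ambient Lie algebra. -/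
def comapInclEquiv (h : t ≤ g) : (t.comap g.incl) ≃ₗ[ℂ] t where
  toFun x := ⟨x.1.1, x.2⟩
  invFun x := ⟨⟨x.1, h x.2⟩, x.2⟩
  map_add' _ _ := rfl
  map_smul' _ _ := rfl

variable [IsKilling ℂ g]

lemma lie_eq_zero_of_isCartanIn (ht : IsCartanIn t g) (h₁ h₂ : t) : ⁅(h₁ : M), (h₂ : M)⁆ = 0 := by
  have := ht.2
  have key : ⁅(comapInclEquiv ht.1).symm h₁, (comapInclEquiv ht.1).symm h₂⁆ = 0 :=
    trivial_lie_zero _ _ _ _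
  exact congrArg (fun x : t.comap g.incl => ((x : g) : M)) key

/-- Cartan elements of a Lie algebra with nondegenerate Killing form act on root spaces by scalars,
so eigenvectors and generalized eigenvectors coincide. -/
lemma mem_weightVectors_iff_mem_rootSpace (ht : IsCartanIn t g) [(t.comap g.incl).IsCartanSubalgebra]
    (x : g) (α : Module.Dual ℂ t) :
    (x : M) ∈ weightVectors t α ↔
      x ∈ rootSpace (t.comap g.incl) (α ∘ comapInclEquiv ht.1) := by
  constructor
  · intro hx
    apply weightSpace_le_genWeightSpace
    rw [mem_weightSpace]
    intro h
    exact Subtype.ext (hx (comapInclEquiv ht.1 h))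
  · intro hx h
    have := IsKilling.lie_eq_smul_of_mem_rootSpace hx ((comapInclEquiv ht.1).symm h)
    exact congrArg (fun x : g => (x : M)) this

lemma exists_weight_of_mem_rootSet (ht : IsCartanIn t g) [(t.comap g.incl).IsCartanSubalgebra]
    {α : Module.Dual ℂ t} (hα : α ∈ rootSet t g) :
    ∃ χ : Weight ℂ (t.comap g.incl) g, χ.IsNonZero ∧ (χ : t.comap g.incl → ℂ) =
      α ∘ comapInclEquiv ht.1 := by
  obtain ⟨h0, x, hxg, hx0, hx⟩ := hα
  have hx' := (mem_weightVectors_iff_mem_rootSpace ht ⟨x, hxg⟩ α).1 hx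
  refine ⟨⟨α ∘ comapInclEquiv ht.1, fun hbot => ?_⟩, fun hz => h0 ?_, rfl⟩
  · replace hx' : _ ∈ genWeightSpace g (α ∘ comapInclEquiv ht.1) := hx'
    rw [hbot] at hx'
    exact hx0 (congrArg (fun x : g => (x : M)) ((LieSubmodule.mem_bot _).1 hx'))
  · ext h
    have := congrFun (Weight.IsZero.eq hz) ((comapInclEquiv ht.1).symm h)
    simpa using this

lemma mem_weightVectors_of_weight (ht : IsCartanIn t g) [(t.comap g.incl).IsCartanSubalgebra]
    (χ : Weight ℂ (t.comap g.incl) g) {x : g} (hx : x ∈ rootSpace (t.comap g.incl) χ) :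
    (x : M) ∈ weightVectors t (χ.toLinear ∘ₗ (comapInclEquiv ht.1).symm.toLinearMap) := by
  refine (mem_weightVectors_iff_mem_rootSpace ht x _).2 ?_
  have h : ((χ.toLinear ∘ₗ (comapInclEquiv ht.1).symm.toLinearMap : Module.Dual ℂ t) : t → ℂ) ∘
      comapInclEquiv ht.1 = χ := by
    ext y
    simp
  rwa [h]

lemma mem_rootSet_of_weight (ht : IsCartanIn t g) [(t.comap g.incl).IsCartanSubalgebra]
    (χ : Weight ℂ (t.comap g.incl) g) (hχ : χ.IsNonZero) :
    (χ.toLinear ∘ₗ (comapInclEquiv ht.1).symm.toLinearMap) ∈ rootSet t g := by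
  obtain ⟨x, hx, hx0⟩ := χ.exists_ne_zero
  refine ⟨fun h => hχ ?_, x, x.2, fun h => hx0 (Subtype.ext h), ?_⟩
  · ext y
    have := LinearMap.congr_fun h (comapInclEquiv ht.1 y)
    simpa using this
  · exact mem_weightVectors_of_weight ht χ hx

/-- Every root of a semisimple Lie algebra has an attached `sl₂`-triple of weight vectors. -/
lemma exists_isSl2Triple_of_mem_rootSet (ht : IsCartanIn t g) {α : Module.Dual ℂ t}
    (hα : α ∈ rootSet t g) :
    ∃ (h : t) (e f : M), IsSl2Triple (h : M) e f ∧ e ∈ g ∧ f ∈ g ∧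
      e ∈ weightVectors t α ∧ f ∈ weightVectors t (-α) ∧ α h = 2 := by
  have := ht.2
  obtain ⟨χ, hχ, hχα⟩ := exists_weight_of_mem_rootSet ht hα
  obtain ⟨h, e, f, htr, he, hf⟩ := IsKilling.exists_isSl2Triple_of_weight_isNonZero hχ
  have hh := htr.h_eq_coroot hχ he hf
  rw [hχα] at he hf
  have he' := (mem_weightVectors_iff_mem_rootSpace ht e α).2 he
  have hf' := (mem_weightVectors_iff_mem_rootSpace ht f (-α)).2 hf
  refine ⟨comapInclEquiv ht.1 (IsKilling.coroot χ), e, f, ?_, e.2, f.2, he', hf', ?_⟩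
  · have hh' : ((comapInclEquiv ht.1 (IsKilling.coroot χ) : t) : M) = h := by rw [hh]; rfl
    rw [hh']
    refine ⟨fun h0 => htr.h_ne_zero (Subtype.ext h0), ?_, ?_, ?_⟩
    · exact congrArg (fun x : g => (x : M)) htr.lie_e_f
    · exact congrArg (fun x : g => (x : M)) htr.lie_h_e_nsmul
    · exact congrArg (fun x : g => (x : M)) htr.lie_h_f_nsmul
  · have := congrFun hχα (IsKilling.coroot χ)
    simpa [IsKilling.root_apply_coroot hχ] using this.symm

lemma exists_smul_eq_of_mem_rootSet (ht : IsCartanIn t g) {α : Module.Dual ℂ t} (hα : α ≠ 0)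
    {x y : M} (hxg : x ∈ g) (hyg : y ∈ g) (hx0 : x ≠ 0)
    (hx : x ∈ weightVectors t α) (hy : y ∈ weightVectors t α) : ∃ c : ℂ, c • x = y := by
  have := ht.2
  obtain ⟨χ, hχ, hχα⟩ := exists_weight_of_mem_rootSet ht ⟨hα, x, hxg, hx0, hx⟩
  have h1 := IsKilling.finrank_rootSpace_eq_one χ hχ
  have hx' := (mem_weightVectors_iff_mem_rootSpace ht ⟨x, hxg⟩ α).1 hx
  have hy' := (mem_weightVectors_iff_mem_rootSpace ht ⟨y, hyg⟩ α).1 hy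
  rw [← hχα] at hx' hy'
  obtain ⟨c, hc⟩ := exists_smul_eq_of_finrank_eq_one h1 (x := ⟨⟨x, hxg⟩, hx'⟩)
    (fun h => hx0 (congrArg (fun z : rootSpace (t.comap g.incl) χ => ((z : g) : M)) h))
    ⟨⟨y, hyg⟩, hy'⟩
  exact ⟨c, congrArg (fun z : rootSpace (t.comap g.incl) χ => ((z : g) : M)) hc⟩

lemma mem_of_forall_lie_eq_zero (ht : IsCartanIn t g) {x : M} (hxg : x ∈ g)
    (hx : ∀ h : t, ⁅(h : M), x⁆ = 0) : x ∈ t := by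
  have := ht.2
  have hx' := (mem_weightVectors_iff_mem_rootSpace ht ⟨x, hxg⟩ 0).1 (fun h => by simp [hx h])
  have h0 : ((0 : Module.Dual ℂ t) : t → ℂ) ∘ comapInclEquiv ht.1 = 0 := rfl
  rw [h0, rootSpace_zero_eq] at hx'
  exact hx'

/-- This is the spanning property of the roots, in dual form. -/
lemma eq_zero_of_forall_root_apply_eq_zero (ht : IsCartanIn t g) {h : t}
    (hh : ∀ α ∈ rootSet t g, α h = 0) : h = 0 := by
  have := ht.2
  have key : (comapInclEquiv ht.1).symm h ∈
      (⨅ χ : Weight ℂ (t.comap g.incl) g, χ.ker) := by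
    rw [Submodule.mem_iInf]
    intro χ
    by_cases hχ : χ.IsZero
    · rw [LinearMap.mem_ker]
      exact congrFun hχ.eq _
    · exact hh _ (mem_rootSet_of_weight ht χ hχ)
  rw [IsKilling.iInf_ker_weight_eq_bot, Submodule.mem_bot] at key
  simpa using key

/-- A Lie subalgebra containing a Cartan subalgebra and all root vectors is everything. -/
lemma le_of_forall_weightVectors (ht : IsCartanIn t g) {N : Submodule ℂ M}
    (htN : ∀ h : t, (h : M) ∈ N)
    (hN : ∀ α ∈ rootSet t g, ∀ x ∈ g, x ∈ weightVectors t α → x ∈ N) : g.toSubmodule ≤ N := by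
  have := ht.2
  intro x hx
  have key := cartan_sup_iSup_rootSpace_eq_top (t.comap g.incl)
  rw [← LieSubmodule.toSubmodule_inj] at key
  simp only [LieSubmodule.sup_toSubmodule, LieSubmodule.iSup_toSubmodule,
    LieSubmodule.top_toSubmodule] at key
  have h2 : (⊤ : Submodule ℂ g) ≤ N.comap g.toSubmodule.subtype := by
    rw [← key]
    refine sup_le (fun y hy => htN ⟨y, hy⟩) (iSup₂_le fun χ hχ y hy => ?_)
    exact hN _ (mem_rootSet_of_weight ht χ hχ) _ y.2 (mem_weightVectors_of_weight ht χ hy)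
  exact h2 (x := ⟨x, hx⟩) trivial

lemma eq_zero_of_isNilpotent_ad (ht : IsCartanIn t g) (h : t) (hn : ∃ k : ℕ, ∀ x ∈ g,
    ((ad ℂ M (h : M)) ^ k) x = 0) : h = 0 := by
  obtain ⟨k, hk⟩ := hn
  refine eq_zero_of_forall_root_apply_eq_zero ht fun α hα => ?_
  obtain ⟨h0, x, hxg, hx0, hx⟩ := hα
  have : ∀ k : ℕ, ((ad ℂ M (h : M)) ^ k) x = (α h) ^ k • x := by
    intro k
    induction k with
    | zero => simp
    | succ k ih => rw [pow_succ', Module.End.mul_apply, ih, map_smul, ad_apply, hx h, smul_smul,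
        pow_succ]
  have h1 := hk x hxg
  rw [this, smul_eq_zero] at h1
  by_contra hne
  exact pow_ne_zero k hne (h1.resolve_right hx0)

end Cartan

/-- Apply e to m repeatedly. The eigenvalues μ + 2n are distinct, so finite-dimensionality ends the
process; the last nonzero vector is primitive, and μ + 2n is a natural number. -/
lemma IsSl2Triple.exists_int_eq {L N : Type*} [LieRing L] [LieAlgebra ℂ L]
    [AddCommGroup N] [Module ℂ N] [LieRingModule L N] [LieModule ℂ L N] [FiniteDimensional ℂ N]
    {h e f : L} (t : IsSl2Triple h e f) {m : N} {μ : ℂ} (hm0 : m ≠ 0) (hm : ⁅h, m⁆ = μ • m) :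
    ∃ z : ℤ, μ = z := by
  let v (n : ℕ) : N := ((toEnd ℂ L N e) ^ n) m
  have h_exists_zero : ∃ k, v k = 0 := by
    by_contra! contra
    have h_inj : Function.Injective fun n : ℕ => μ + 2 * (n : ℂ) := fun a b hab => by
      simpa using hab
    have aux (ν : Set.range fun n : ℕ => μ + 2 * (n : ℂ)) :
        (toEnd ℂ L N h).HasEigenvector ν (v ν.property.choose) := by
      set n := ν.property.choose
      refine ⟨?_, contra n⟩
      rw [Module.End.mem_eigenspace_iff, toEnd_apply_apply, ← ν.property.choose_spec]
      exact t.lie_h_pow_toEnd_e hm n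
    have _i := ((toEnd ℂ L N h).eigenvectors_linearIndependent (Set.range _) _ aux).finite
    exact (Set.infinite_range_of_injective h_inj) (Set.toFinite _)
  obtain ⟨n, hn_ne, hn_zero⟩ := Nat.exists_not_and_succ_of_not_zero_of_exists hm0 h_exists_zero
  have P : t.HasPrimitiveVectorWith (v n) (μ + 2 * n) :=
    { ne_zero := hn_ne
      lie_h := t.lie_h_pow_toEnd_e hm n
      lie_e := by rw [IsSl2Triple.lie_e_pow_toEnd_e]; exact hn_zero }
  obtain ⟨k, hk⟩ := P.exists_nat
  refine ⟨k - 2 * n, ?_⟩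
  push_cast
  linear_combination hk

/-! ### The trace form: invariance and positivity. -/

section TraceForm

variable {V : Type*} [AddCommGroup V] [Module ℂ V]

lemma trace_mul_eq_of_lie_eq {h e f H : Module.End ℂ V} {a : ℂ} (hH : ⁅e, f⁆ = H)
    (he : ⁅h, e⁆ = a • e) : LinearMap.trace ℂ V (h * H) = a * LinearMap.trace ℂ V (e * f) := by
  have h1 : a * LinearMap.trace ℂ V (e * f) = LinearMap.trace ℂ V ((a • e) * f) := by
    rw [smul_mul_assoc, map_smul, smul_eq_mul]
  rw [h1, ← he, ← hH, Ring.lie_def, Ring.lie_def, mul_sub,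
    sub_mul, map_sub, map_sub, ← mul_assoc, ← mul_assoc, LinearMap.trace_mul_cycle ℂ h f e,
    mul_assoc e h f, LinearMap.trace_mul_comm ℂ e (h * f)]

/-- Up to scale, the coroot is dual to the root under the trace form. Only the weight of e enters,
which makes roots of different algebras comparable. -/
lemma IsSl2Triple.two_mul_trace_mul {h H e f : Module.End ℂ V} (t : IsSl2Triple H e f) {a : ℂ}
    (he : ⁅h, e⁆ = a • e) :
    2 * LinearMap.trace ℂ V (h * H) = a * LinearMap.trace ℂ V (H * H) := by
  rw [trace_mul_eq_of_lie_eq t.lie_e_f he,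
    trace_mul_eq_of_lie_eq t.lie_e_f (t.lie_h_e_smul ℂ)]
  ring

variable [FiniteDimensional ℂ V] {t : LieSubalgebra ℂ (Module.End ℂ V)} [IsLieAbelian t]

/-- The space is the sum of its generalized weight spaces, and h has generalized eigenvalue 0 on
each. -/
lemma isNilpotent_of_forall_weight_eq_zero {h : t} (hh : ∀ χ : Weight ℂ t V, χ h = 0) :
    _root_.IsNilpotent (h : Module.End ℂ V) := by
  have key : (h : Module.End ℂ V).maxGenEigenspace 0 = ⊤ := by
    have h1 := iSup_genWeightSpace_eq_top' ℂ t V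
    rw [← LieSubmodule.toSubmodule_inj, LieSubmodule.iSup_toSubmodule,
      LieSubmodule.top_toSubmodule] at h1
    rw [eq_top_iff, ← h1]
    refine iSup_le fun χ => ?_
    have h2 := genWeightSpace_le_genWeightSpaceOf V h χ
    rw [hh χ] at h2
    exact h2
  rw [Module.End.maxGenEigenspace_eq] at key
  refine ⟨(h : Module.End ℂ V).maxGenEigenspaceIndex 0, LinearMap.ext fun v => ?_⟩
  have hv : v ∈ (⊤ : Submodule ℂ V) := trivial
  rw [← key, Module.End.mem_genEigenspace_nat] at hv
  simpa using hv

lemma IsSl2Triple.exists_int_weight_eq {H : t} {e f : Module.End ℂ V}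
    (tr : IsSl2Triple (H : Module.End ℂ V) e f) (χ : Weight ℂ t V) : ∃ z : ℤ, χ H = z := by
  obtain ⟨m, hm0, hm⟩ := exists_forall_lie_eq_smul (R := ℂ) (L := t) (M := V) χ
  exact tr.exists_int_eq (N := V) hm0 (hm H)

lemma trace_mul_eq_sum (h h' : t) : LinearMap.trace ℂ V ((h : Module.End ℂ V) * h') =
    ∑ χ : Weight ℂ t V, Module.finrank ℂ (genWeightSpace V χ) • (χ h * χ h') :=
  traceForm_eq_sum_finrank_nsmul_mul (K := ℂ) (L := t) (M := V) h h'

/-- The Cauchy–Schwarz inequality for the trace form on elements with integral weights. -/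
lemma exists_real_trace_eq {H H' : t} (hH : ∀ χ : Weight ℂ t V, ∃ z : ℤ, χ H = z)
    (hH' : ∀ χ : Weight ℂ t V, ∃ z : ℤ, χ H' = z) :
    ∃ s p s' : ℝ, LinearMap.trace ℂ V ((H : Module.End ℂ V) * H) = s ∧
      LinearMap.trace ℂ V ((H : Module.End ℂ V) * H') = p ∧
      LinearMap.trace ℂ V ((H' : Module.End ℂ V) * H') = s' ∧ 0 ≤ s ∧ 0 ≤ s' ∧
      (s = 0 → ∀ χ : Weight ℂ t V, χ H = 0) ∧ (s' = 0 → ∀ χ : Weight ℂ t V, χ H' = 0) ∧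
      0 ≤ s * (s * s' - p ^ 2) ∧
      (s * s' = p ^ 2 → ∀ χ : Weight ℂ t V, χ ((s : ℂ) • H' - (p : ℂ) • H) = 0) := by
  choose a ha using hH
  choose b hb using hH'
  let m : Weight ℂ t V → ℝ := fun χ => (Module.finrank ℂ (genWeightSpace V χ) : ℝ)
  have hm : ∀ χ, 0 < m χ := fun χ => by
    have := zero_lt_finrank_genWeightSpace (R := ℂ) (L := t) (M := V) χ.genWeightSpace_ne_bot
    exact Nat.cast_pos.2 this
  set s : ℝ := ∑ χ, m χ * (a χ * a χ) with hs
  set p : ℝ := ∑ χ, m χ * (a χ * b χ) with hp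
  set s' : ℝ := ∑ χ, m χ * (b χ * b χ) with hs'
  have hz : ∀ c : Weight ℂ t V → ℝ, ∑ χ, m χ * (c χ * c χ) = 0 → ∀ χ, c χ = 0 := by
    intro c hc χ
    have := (Finset.sum_eq_zero_iff_of_nonneg
      (fun χ _ => mul_nonneg (hm χ).le (mul_self_nonneg _))).1 hc χ (Finset.mem_univ _)
    exact mul_self_eq_zero.1 ((mul_eq_zero.1 this).resolve_left (hm χ).ne')
  -- The squared length of s H' - p H is s times the Gram determinant.
  have hQ : ∑ χ, m χ * ((s * b χ - p * a χ) * (s * b χ - p * a χ)) = s * (s * s' - p ^ 2) := by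
    have : ∀ χ, m χ * ((s * b χ - p * a χ) * (s * b χ - p * a χ)) =
        s ^ 2 * (m χ * (b χ * b χ)) - 2 * s * p * (m χ * (a χ * b χ)) +
          p ^ 2 * (m χ * (a χ * a χ)) := fun χ => by ring
    simp_rw [this, Finset.sum_add_distrib, Finset.sum_sub_distrib, ← Finset.mul_sum]
    rw [← hs, ← hp, ← hs']
    ring
  refine ⟨s, p, s', ?_, ?_, ?_, Finset.sum_nonneg fun χ _ => mul_nonneg (hm χ).le
    (mul_self_nonneg _), Finset.sum_nonneg fun χ _ => mul_nonneg (hm χ).le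
    (mul_self_nonneg _), ?_, ?_, ?_, ?_⟩
  · rw [trace_mul_eq_sum, hs]; push_cast; simp [ha, m]
  · rw [trace_mul_eq_sum, hp]; push_cast; simp [ha, hb, m]
  · rw [trace_mul_eq_sum, hs']; push_cast; simp [hb, m]
  · intro h0 χ
    have := hz _ h0 χ
    rw [ha]
    exact_mod_cast this
  · intro h0 χ
    have := hz _ h0 χ
    rw [hb]
    exact_mod_cast this
  · rw [← hQ]
    exact Finset.sum_nonneg fun χ _ => mul_nonneg (hm χ).le (mul_self_nonneg _)
  · intro h0 χ
    rw [h0, sub_self, mul_zero] at hQ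
    have h1 := hz _ hQ χ
    have h2 : χ ((s : ℂ) • H' - (p : ℂ) • H) = (s : ℂ) * χ H' - (p : ℂ) * χ H := by
      simpa using map_sub (χ.toLinear) ((s : ℂ) • H') ((p : ℂ) • H)
    rw [h2, ha, hb]
    exact_mod_cast h1

end TraceForm

/-! ### Arithmetic of the numbers N j (m - j) / m. -/

section Arithmetic

/-- The value m - 1 arises from N = 1 and j = 1 or m - 1. All other nonzero values are at least 2 (m
- 2), and 2 (m - 2) ≥ 10 m / 7 exactly when m ≥ 7. -/
lemma mul_mul_sub_cases {m N j : ℕ} (hm : 7 ≤ m) (hN : 1 ≤ N) (hj : j ≤ m) :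
    N * (j * (m - j)) = 0 ∨ N * (j * (m - j)) + 1 = m ∨ 10 * m ≤ 7 * (N * (j * (m - j))) := by
  obtain ⟨l, rfl⟩ := Nat.exists_eq_add_of_le hj
  rw [Nat.add_sub_cancel_left]
  have hN' : j * l ≤ N * (j * l) := Nat.le_mul_of_pos_left _ hN
  have hN'' : N = 1 ∨ 2 * (j * l) ≤ N * (j * l) := by
    rcases hN.eq_or_lt with h | h
    · exact Or.inl h.symm
    · exact Or.inr (Nat.mul_le_mul_right _ h)
  rcases Nat.lt_or_ge j 2 with h | h
  · interval_cases j
    · simp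
    · rcases hN'' with rfl | h2 <;> omega
  · rcases Nat.lt_or_ge l 2 with h' | h'
    · interval_cases l
      · simp
      · rcases hN'' with rfl | h2 <;> omega
    · right; right
      have : 2 * (j + l - 2) ≤ j * l := by
        obtain ⟨a, rfl⟩ := Nat.exists_eq_add_of_le h
        obtain ⟨b, rfl⟩ := Nat.exists_eq_add_of_le h'
        have : (2 + a + (2 + b) - 2) = 2 + a + b := by omega
        rw [this]
        nlinarith [Nat.zero_le (a * b)]
      omega

/-- Up to order, the only solutions (N; j, m - j) of the equation with N ≤ 3 and m ≥ 1 are (3; 1,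
2), (2; 2, 2), (1; 4, 4) and (1; 3, 6), with m = 3, 4, 8, 9. -/
lemma mul_mul_sub_ne {m N j : ℕ} (hm : m ∉ ({1, 2, 3, 4, 6, 8, 9} : Set ℕ)) (hN : 1 ≤ N)
    (hN3 : N ≤ 3) (hj : j ≤ m) (hm0 : 1 ≤ m) : N * (j * (m - j)) ≠ 2 * m := by
  simp only [Set.mem_insert_iff, Set.mem_singleton_iff, not_or] at hm
  obtain ⟨l, rfl⟩ := Nat.exists_eq_add_of_le hj
  rw [Nat.add_sub_cancel_left]
  intro h
  have key : ∀ a b : ℕ, a ≤ b → N * (a * b) = 2 * (a + b) → a + b ≠ 1 → a + b ≠ 2 →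
      a + b ≠ 3 → a + b ≠ 4 → a + b ≠ 6 → a + b ≠ 8 → a + b ≠ 9 → 1 ≤ a + b → False := by
    intro a b hab h
    -- If a ≥ 5, then N a b ≥ 5 b > 4 b ≥ 2 (a + b).
    have ha : a ≤ 4 := by
      by_contra! h5
      have h1 := Nat.le_mul_of_pos_left (a * b) hN
      have h2 : 5 * b ≤ a * b := Nat.mul_le_mul_right _ h5
      omega
    interval_cases a <;> interval_cases N <;> omega
  rcases le_total j l with hjl | hjl
  · exact key j l hjl h (by tauto) (by tauto) (by tauto) (by tauto) (by tauto) (by tauto)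
      (by tauto) hm0
  · have := key l j hjl (by rw [mul_comm l, h, add_comm])
    rw [add_comm l] at this
    exact this (by tauto) (by tauto) (by tauto) (by tauto) (by tauto) (by tauto) (by tauto) hm0

lemma mul_mul_sub_five_cases {N j : ℕ} (hN : 1 ≤ N) (hN3 : N ≤ 3) (hj : j ≤ 5) :
    N * (j * (5 - j)) = 0 ∨ N * (j * (5 - j)) = 4 ∨ N * (j * (5 - j)) = 6 ∨
      8 ≤ N * (j * (5 - j)) := by
  interval_cases j <;> omega

/-- Nonzero terms are at least 4/5, so at most two occur, and a single one is never 2. Two terms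
with m ≥ 7 are either both below 1 or add up to at least 16/7. A term with m = 5 would need a
partner equal to 6/5, 4/5 or at most 2/5, which no m ≥ 7 supplies. The sum 4/5 + 6/5 from two
factors with m = 5 is what `h5` rules out. -/
lemma sum_mul_mul_sub_div_ne_two {I : Type*} [Fintype I] (m N j : I → ℕ)
    (hm : ∀ i, m i ∉ ({1, 2, 3, 4, 6, 8, 9} : Set ℕ)) (hm0 : ∀ i, 1 ≤ m i)
    (h5 : ∀ i l, m i = 5 → m l = 5 → i = l) (hN : ∀ i, 1 ≤ N i) (hN3 : ∀ i, N i ≤ 3)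
    (hj : ∀ i, j i ≤ m i) :
    ∑ i, ((N i * (j i * (m i - j i)) : ℕ) : ℝ) / m i ≠ 2 := by
  classical
  intro hsum
  set T : I → ℝ := fun i => ((N i * (j i * (m i - j i)) : ℕ) : ℝ) / m i with hT
  have hmpos : ∀ i, (0 : ℝ) < m i := fun i => by exact_mod_cast hm0 i
  have hT2 : ∀ i, T i ≠ 2 := fun i h => by
    rw [hT, div_eq_iff (hmpos i).ne'] at h
    exact mul_mul_sub_ne (hm i) (hN i) (hN3 i) (hj i) (hm0 i) (by exact_mod_cast h)
  have hcase : ∀ i, m i = 5 ∨ 7 ≤ m i := fun i => by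
    have h1 := hm i
    have h2 := hm0 i
    simp only [Set.mem_insert_iff, Set.mem_singleton_iff, not_or] at h1
    omega
  have hT5 : ∀ i, m i = 5 → T i = 0 ∨ T i = 4 / 5 ∨ T i = 6 / 5 ∨ 8 / 5 ≤ T i := by
    intro i hi
    have h1 := mul_mul_sub_five_cases (hN i) (hN3 i) (hi ▸ hj i)
    simp only [hT, hi]
    generalize N i * (j i * (5 - j i)) = K at h1
    rcases h1 with rfl | rfl | rfl | h
    · simp
    · norm_num
    · norm_num
    · right; right; right
      have : (8 : ℝ) ≤ K := by exact_mod_cast h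
      push_cast
      linarith
  have hT7 : ∀ i, 7 ≤ m i → T i = 0 ∨ (6 / 7 ≤ T i ∧ T i < 1) ∨ 10 / 7 ≤ T i := by
    intro i hi
    have h1 := mul_mul_sub_cases hi (hN i) (hj i)
    have h7 : (7 : ℝ) ≤ m i := by exact_mod_cast hi
    have hp := hmpos i
    simp only [hT]
    generalize N i * (j i * (m i - j i)) = K at h1
    rcases h1 with rfl | h | h
    · simp
    · right; left
      have : (K : ℝ) + 1 = m i := by exact_mod_cast h
      rw [le_div_iff₀ hp, div_lt_one hp]
      constructor <;> linarith
    · right; right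
      have : 10 * (m i : ℝ) ≤ 7 * K := by exact_mod_cast h
      rw [le_div_iff₀ hp]
      linarith
  have hmin : ∀ i, T i = 0 ∨ 4 / 5 ≤ T i := by
    intro i
    rcases hcase i with h | h
    · rcases hT5 i h with h | h | h | h
      · exact Or.inl h
      all_goals right; linarith
    · rcases hT7 i h with h | h | h
      · exact Or.inl h
      · right; linarith [h.1]
      · right; linarith
  have hnn : ∀ i, 0 ≤ T i := fun i => by rcases hmin i with h | h <;> linarith
  obtain ⟨i, -, hi⟩ : ∃ i ∈ Finset.univ, T i ≠ 0 := by
    by_contra! h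
    rw [Finset.sum_eq_zero h] at hsum
    norm_num at hsum
  have hi' := (hmin i).resolve_left hi
  have hsum1 := Finset.add_sum_erase Finset.univ T (Finset.mem_univ i)
  obtain ⟨l, hl, hl0⟩ : ∃ l ∈ Finset.univ.erase i, T l ≠ 0 := by
    by_contra! h
    rw [Finset.sum_eq_zero h, hsum, add_zero] at hsum1
    exact hT2 i hsum1
  have hl' := (hmin l).resolve_left hl0
  have hli := Finset.ne_of_mem_erase hl
  have hsum2 := Finset.add_sum_erase _ T hl
  have hrest : ∑ x ∈ (Finset.univ.erase i).erase l, T x = 0 := by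
    by_contra h
    obtain ⟨r, hr, hr0⟩ := Finset.exists_ne_zero_of_sum_ne_zero h
    have hr' := (hmin r).resolve_left hr0
    have := Finset.single_le_sum (fun x _ => hnn x) hr
    linarith
  have htot : T i + T l = 2 := by linarith
  rcases hcase i with h | h <;> rcases hcase l with h' | h'
  · exact hli (h5 _ _ h' h)
  · rcases hT5 i h with h | h | h | h <;> rcases hT7 l h' with h' | h' | h' <;>
      first | exact hi h | exact hl0 h' | (try have := h'.1); (try have := h'.2); linarith
  · rcases hT5 l h' with h' | h' | h' | h' <;> rcases hT7 i h with h | h | h <;>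
      first | exact hi h | exact hl0 h' | (try have := h.1); (try have := h.2); linarith
  · rcases hT7 i h with h | h | h <;> rcases hT7 l h' with h' | h' | h' <;>
      first | exact hi h | exact hl0 h' | (try have := h.2); (try have := h'.2); linarith

/-- The possible pairs (d, w) are (1, 1), (1, 2), (2, 1), (1, 3), (3, 1), and their ratios are
distinct. -/
lemma natAbs_eq_of_mul_lt_four {d w d' w' : ℕ} (hd : d ≠ 0) (hw : w ≠ 0) (hd' : d' ≠ 0)
    (hw' : w' ≠ 0) (h : d * w < 4) (h' : d' * w' < 4) (heq : w * d' = w' * d) : d = d' := by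
  have h1 : d < 4 := by nlinarith [Nat.pos_of_ne_zero hw]
  have h2 : w < 4 := by nlinarith [Nat.pos_of_ne_zero hd]
  have h3 : d' < 4 := by nlinarith [Nat.pos_of_ne_zero hw']
  interval_cases d <;> interval_cases w <;> interval_cases d' <;> omega

/-- A family of integers whose differences satisfy the crystallographic bounds takes at most two
values. -/
lemma exists_finset_forall_sub_sq_eq {ι : Type*} [Fintype ι] [DecidableEq ι] (z : ι → ℤ) {τ : ℝ} (hτ : 0 < τ)
    (hint : ∀ a b, ∃ w : ℤ, τ * ((z a - z b : ℤ) : ℝ) = w)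
    (hlt : ∀ a b, τ * ((z a - z b : ℤ) : ℝ) ^ 2 < 4) :
    ∃ N : ℕ, 1 ≤ N ∧ N ≤ 3 ∧ ∃ S : Finset ι, ∀ a b,
      τ * ((z a - z b : ℤ) : ℝ) ^ 2 = N * ((if a ∈ S then 1 else 0) - (if b ∈ S then 1 else 0)) ^ 2 := by
  by_cases hall : ∀ a b, z a = z b
  · exact ⟨1, le_rfl, by norm_num, ∅, fun a b => by simp [hall a b]⟩
  push Not at hall
  obtain ⟨a₀, b₀, h₀⟩ := hall
  have key : ∀ a b, z a ≠ z b → ∃ w : ℕ, w ≠ 0 ∧ (z a - z b).natAbs * w < 4 ∧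
      τ * (z a - z b).natAbs = w := by
    intro a b hab
    obtain ⟨w, hw⟩ := hint a b
    have hne : ((z a - z b : ℤ) : ℝ) ≠ 0 := by exact_mod_cast sub_ne_zero.2 hab
    have habs : τ * ((z a - z b).natAbs : ℝ) = (w.natAbs : ℝ) := by
      rw [Nat.cast_natAbs, Nat.cast_natAbs, Int.cast_abs, Int.cast_abs, ← hw, abs_mul,
        abs_of_pos hτ]
    refine ⟨w.natAbs, fun h => ?_, ?_, habs⟩
    · rw [Int.natAbs_eq_zero.1 h, Int.cast_zero] at hw
      exact (mul_ne_zero hτ.ne' hne) hw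
    · have h1 := hlt a b
      have h2 : (((z a - z b).natAbs * w.natAbs : ℕ) : ℝ) = τ * ((z a - z b : ℤ) : ℝ) ^ 2 := by
        rw [Nat.cast_mul, ← habs, Nat.cast_natAbs, Int.cast_abs, ← sq_abs]
        ring
      rw [← h2] at h1
      exact_mod_cast h1
  obtain ⟨w₀, hw₀, hlt₀, heq₀⟩ := key a₀ b₀ h₀
  have hd0 : ∀ a b, z a ≠ z b → (z a - z b).natAbs ≠ 0 := fun a b h =>
    Int.natAbs_ne_zero.2 (sub_ne_zero.2 h)
  -- All pairs share the ratio w / |z a - z b| = τ, so all nonzero differences have the same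
  -- absolute value.
  have hconst : ∀ a b, z a ≠ z b → (z a - z b).natAbs = (z a₀ - z b₀).natAbs := by
    intro a b hab
    obtain ⟨w, hw, hltw, heq⟩ := key a b hab
    refine natAbs_eq_of_mul_lt_four (hd0 a b hab) hw (hd0 _ _ h₀) hw₀ hltw hlt₀ ?_
    have : (w : ℝ) * (z a₀ - z b₀).natAbs = w₀ * (z a - z b).natAbs := by
      rw [← heq, ← heq₀]; ring
    exact_mod_cast this
  have hsq : ∀ a b, z a ≠ z b → τ * ((z a - z b : ℤ) : ℝ) ^ 2 =
      (((z a₀ - z b₀).natAbs * w₀ : ℕ) : ℝ) := by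
    intro a b hab
    rw [← sq_abs, ← Int.cast_abs, ← Nat.cast_natAbs, hconst a b hab, Nat.cast_mul, ← heq₀]
    ring
  refine ⟨(z a₀ - z b₀).natAbs * w₀, Nat.one_le_iff_ne_zero.2 (mul_ne_zero (hd0 _ _ h₀) hw₀),
    by omega, Finset.univ.filter fun a => z a = z a₀, fun a b => ?_⟩
  simp only [Finset.mem_filter, Finset.mem_univ, true_and]
  by_cases ha : z a = z a₀ <;> by_cases hb : z b = z a₀
  · simp [ha, hb]
  · rw [hsq a b (fun h => hb (h ▸ ha))]
    simp [ha, hb]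
  · rw [hsq a b (fun h => ha (h.trans hb))]
    simp [ha, hb]
  -- Three distinct integers cannot be pairwise equidistant.
  · have hab : z a = z b := by
      by_contra hab
      have h1 := hconst a b hab
      have h2 := hconst a a₀ ha
      have h3 := hconst b a₀ hb
      omega
    simp [hab, hb]

lemma sum_sum_indicator_sub_sq {ι : Type*} [Fintype ι] [DecidableEq ι] (S : Finset ι) :
    ∑ a, ∑ b, (((if a ∈ S then 1 else 0) - (if b ∈ S then 1 else 0) : ℝ)) ^ 2 =
      2 * ((S.card * (Fintype.card ι - S.card) : ℕ) : ℝ) := by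
  have h : ∀ a b : ι, (((if a ∈ S then 1 else 0) - (if b ∈ S then 1 else 0) : ℝ)) ^ 2 =
      (if a ∈ S then 1 else 0) + (if b ∈ S then 1 else 0) -
        2 * (if a ∈ S then 1 else 0) * (if b ∈ S then 1 else 0) := by
    intro a b
    split_ifs <;> norm_num
  simp_rw [h, Finset.sum_sub_distrib, Finset.sum_add_distrib, ← Finset.mul_sum]
  simp only [Finset.sum_const, Finset.card_univ, ← Finset.mul_sum, ← Finset.sum_mul]
  rw [Nat.cast_mul, Nat.cast_sub (Finset.card_le_univ S)]
  simp
  ring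

end Arithmetic

/-! ### Traceless matrix units. -/

section TracelessUnits

variable {m : Type*} [Fintype m] [DecidableEq m]

/-- The traceless part of the matrix unit with index `(a, b)`. -/
noncomputable def tracelessUnit (a b : m) : Matrix m m ℂ :=
  Matrix.single a b 1 - (if a = b then (Fintype.card m : ℂ)⁻¹ else 0) • 1

lemma trace_tracelessUnit (a b : m) : (tracelessUnit a b).trace = 0 := by
  have : (Fintype.card m : ℂ) ≠ 0 := by
    have := Fintype.card_pos_iff.2 ⟨a⟩
    exact_mod_cast this.ne'
  by_cases h : a = b
  · subst h
    simp [tracelessUnit, this]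
  · simp [tracelessUnit, h]

/-- The scalar corrections are central, and on the right they cancel when both conditions hold. -/
lemma lie_tracelessUnit (a b c d : m) : ⁅tracelessUnit a b, tracelessUnit c d⁆ =
    (if b = c then tracelessUnit a d else 0) - (if d = a then tracelessUnit c b else 0) := by
  have h1 : ⁅tracelessUnit a b, tracelessUnit c d⁆ =
      (Matrix.single a b 1 * Matrix.single c d 1 - Matrix.single c d 1 * Matrix.single a b 1 :
        Matrix m m ℂ) := by
    simp only [tracelessUnit, Ring.lie_def]
    simp only [sub_mul, mul_sub, smul_mul_assoc, mul_smul_comm, one_mul, mul_one]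
    module
  rw [h1]
  by_cases hbc : b = c <;> by_cases hda : d = a
  · subst hbc hda
    simp only [Matrix.single_mul_single_same, tracelessUnit, if_true, one_mul]
    abel
  · subst hbc
    have : a ≠ d := fun h => hda h.symm
    simp [tracelessUnit, hda, this]
  · subst hda
    have : c ≠ b := fun h => hbc h.symm
    simp [tracelessUnit, hbc, this]
  · simp [hbc, hda]

lemma diagonal_lie_tracelessUnit (v : m → ℂ) (a b : m) :
    ⁅Matrix.diagonal v, tracelessUnit a b⁆ = (v a - v b) • tracelessUnit a b := by
  have h1 : ⁅Matrix.diagonal v, tracelessUnit a b⁆ =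
      (Matrix.diagonal v * Matrix.single a b 1 - Matrix.single a b 1 * Matrix.diagonal v) := by
    simp only [tracelessUnit, Ring.lie_def, sub_mul, mul_sub, smul_mul_assoc, mul_smul_comm,
      one_mul, mul_one]
    abel
  rw [h1]
  ext i j
  by_cases hab : a = b
  · subst hab
    simp only [sub_self, zero_smul, Matrix.sub_apply, Matrix.diagonal_mul, Matrix.mul_diagonal,
      Matrix.single_apply, Matrix.zero_apply]
    split_ifs with h
    · rw [← h.1, ← h.2]; ring
    · ring
  · simp only [tracelessUnit, hab, if_false, zero_smul, sub_zero, Matrix.sub_apply,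
      Matrix.diagonal_mul, Matrix.mul_diagonal, Matrix.smul_apply, Matrix.single_apply, smul_eq_mul]
    split_ifs with h
    · rw [← h.1, ← h.2]; ring
    · ring

lemma sum_smul_tracelessUnit {A : Matrix m m ℂ} (hA : A.trace = 0) :
    ∑ a, ∑ b, A a b • tracelessUnit a b = A := by
  simp only [tracelessUnit, smul_sub, Finset.sum_sub_distrib]
  have h1 : ∑ a, ∑ b, A a b • Matrix.single a b (1 : ℂ) = A := by
    conv_rhs => rw [Matrix.matrix_eq_sum_single A]
    simp [Matrix.smul_single]
  have h2 : ∑ a, ∑ b, A a b • ((if a = b then (Fintype.card m : ℂ)⁻¹ else 0) • (1 : Matrix m m ℂ))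
      = 0 := by
    have : ∀ a, ∑ b, A a b • ((if a = b then (Fintype.card m : ℂ)⁻¹ else 0) • (1 : Matrix m m ℂ)) =
        A a a • ((Fintype.card m : ℂ)⁻¹ • (1 : Matrix m m ℂ)) := fun a => by
      rw [Finset.sum_eq_single a]
      · simp
      · intro b _ hb
        simp [hb.symm]
      · simp
    simp_rw [this, ← Finset.sum_smul]
    have h3 : ∑ a, A a a = 0 := hA
    rw [h3, zero_smul]
  rw [h1, h2, sub_zero]

end TracelessUnits

/-! ### Coordinates on a product of special linear algebras. -/

section SLCoords

variable {M : Type*} [LieRing M] [LieAlgebra ℂ M]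

/-- An identification of `g` with a product of special linear Lie algebras, taking `t` to the
diagonal matrices. -/
structure SLCoords {I : Type*} (t g : LieSubalgebra ℂ M) (n : I → ℕ) where
  le : t ≤ g
  coord (i : I) : g →ₗ⁅ℂ⁆ Matrix (Fin (n i + 1)) (Fin (n i + 1)) ℂ
  trace_coord (i : I) (x : g) : (coord i x).trace = 0
  exists_coord_eq (A : ∀ i, Matrix (Fin (n i + 1)) (Fin (n i + 1)) ℂ) (hA : ∀ i, (A i).trace = 0) :
    ∃ x, ∀ i, coord i x = A i
  eq_zero (x : g) (hx : ∀ i, coord i x = 0) : x = 0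
  mem_iff (x : g) : (x : M) ∈ t ↔ ∀ i, (coord i x).IsDiag

namespace SLCoords

variable {I : Type*} {t g : LieSubalgebra ℂ M} {n : I → ℕ} (c : SLCoords t g n)

lemma ext_coord {x y : g} (h : ∀ i, c.coord i x = c.coord i y) : x = y :=
  sub_eq_zero.1 (c.eq_zero _ fun i => by rw [map_sub, h, sub_self])

/-- The diagonal coordinates on `t`. -/
noncomputable def ε (i : I) (a : Fin (n i + 1)) : Module.Dual ℂ t where
  toFun h := c.coord i ⟨h, c.le h.2⟩ a a
  map_add' h h' := by
    have : (⟨(h + h' : t), c.le (h + h').2⟩ : g) = ⟨h, c.le h.2⟩ + ⟨h', c.le h'.2⟩ := rfl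
    rw [this, map_add, Matrix.add_apply]
  map_smul' z h := by
    have : (⟨(z • h : t), c.le (z • h).2⟩ : g) = z • ⟨h, c.le h.2⟩ := rfl
    rw [this, map_smul, Matrix.smul_apply]
    rfl

lemma coord_eq_diagonal (i : I) (h : t) :
    c.coord i ⟨h, c.le h.2⟩ = Matrix.diagonal fun a => c.ε i a h :=
  (((c.mem_iff ⟨h, c.le h.2⟩).1 h.2 i).diagonal_diag).symm

lemma sum_ε_apply (i : I) (h : t) : ∑ a, c.ε i a h = 0 := c.trace_coord i ⟨h, c.le h.2⟩

lemma eq_of_ε_eq {h h' : t} (hh : ∀ i a, c.ε i a h = c.ε i a h') : h = h' := by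
  have : (⟨h, c.le h.2⟩ : g) = ⟨h', c.le h'.2⟩ :=
    c.ext_coord fun i => by simp only [coord_eq_diagonal, hh]
  exact Subtype.ext (congrArg (Subtype.val : g → M) this)

variable [DecidableEq I]

lemma exists_unit (i : I) (a b : Fin (n i + 1)) : ∃ x : g, ∀ l,
    c.coord l x =
      (Pi.single i (tracelessUnit a b) : ∀ l, Matrix (Fin (n l + 1)) (Fin (n l + 1)) ℂ) l := by
  refine c.exists_coord_eq _ fun l => ?_
  by_cases h : l = i
  · subst h
    rw [Pi.single_eq_same, trace_tracelessUnit]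
  · rw [Pi.single_eq_of_ne h, Matrix.trace_zero]

/-- The elements of `g` corresponding to the traceless parts of the matrix units. -/
noncomputable def unit (i : I) (a b : Fin (n i + 1)) : g := (c.exists_unit i a b).choose

@[simp] lemma coord_unit_same (i : I) (a b : Fin (n i + 1)) :
    c.coord i (c.unit i a b) = tracelessUnit a b := by
  rw [unit, (c.exists_unit i a b).choose_spec, Pi.single_eq_same]

lemma coord_unit_of_ne {i l : I} (h : l ≠ i) (a b : Fin (n i + 1)) :
    c.coord l (c.unit i a b) = 0 := by
  rw [unit, (c.exists_unit i a b).choose_spec, Pi.single_eq_of_ne h]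

lemma lie_unit (i : I) (a b a' b' : Fin (n i + 1)) : ⁅c.unit i a b, c.unit i a' b'⁆ =
    (if b = a' then c.unit i a b' else 0) - (if b' = a then c.unit i a' b else 0) := by
  refine c.ext_coord fun l => ?_
  by_cases h : l = i
  · subst h
    rw [LieHom.map_lie, coord_unit_same, coord_unit_same, lie_tracelessUnit, map_sub]
    congr 1 <;> split_ifs <;> simp
  · rw [LieHom.map_lie, coord_unit_of_ne c h, zero_lie, map_sub]
    split_ifs <;> simp [coord_unit_of_ne c h]

lemma unit_mem_weightVectors (i : I) (a b : Fin (n i + 1)) :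
    (c.unit i a b : M) ∈ weightVectors t (c.ε i a - c.ε i b) := by
  intro h
  have : ⁅(⟨h, c.le h.2⟩ : g), c.unit i a b⁆ = (c.ε i a - c.ε i b) h • c.unit i a b := by
    refine c.ext_coord fun l => ?_
    by_cases hl : l = i
    · subst hl
      rw [LieHom.map_lie, map_smul, coord_unit_same, coord_eq_diagonal, diagonal_lie_tracelessUnit]
      rfl
    · rw [LieHom.map_lie, map_smul, coord_unit_of_ne c hl, lie_zero, smul_zero]
  exact congrArg Subtype.val this

lemma unit_self_mem (i : I) (a : Fin (n i + 1)) : (c.unit i a a : M) ∈ t := by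
  rw [mem_iff]
  intro l
  by_cases hl : l = i
  · subst hl
    rw [coord_unit_same, tracelessUnit]
    intro x y hxy
    have h : ¬ (a = x ∧ a = y) := fun h => hxy (h.1.symm.trans h.2)
    simp [hxy, h]
  · rw [coord_unit_of_ne c hl]
    exact Matrix.isDiag_zero

/-- The diagonal elements of `t` dual to the coordinates `ε`, up to trace. -/
noncomputable def D (i : I) (a : Fin (n i + 1)) : t := ⟨c.unit i a a, c.unit_self_mem i a⟩

lemma coe_D (i : I) (a : Fin (n i + 1)) : (c.D i a : M) = c.unit i a a := rfl

lemma ε_D_same (i : I) (a b : Fin (n i + 1)) :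
    c.ε i a (c.D i b) = (if a = b then 1 else 0) - ((n i : ℂ) + 1)⁻¹ := by
  have : c.ε i a (c.D i b) = c.coord i (c.unit i b b) a a := rfl
  rw [this, coord_unit_same, tracelessUnit]
  by_cases h : a = b
  · simp [h]
  · have h' : b ≠ a := fun h' => h h'.symm
    simp [h, h']

lemma ε_D_of_ne {i l : I} (h : l ≠ i) (a : Fin (n l + 1)) (b : Fin (n i + 1)) :
    c.ε l a (c.D i b) = 0 := by
  have : c.ε l a (c.D i b) = c.coord l (c.unit i b b) a a := rfl
  rw [this, coord_unit_of_ne c h, Matrix.zero_apply]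

lemma sum_D (i : I) : ∑ a, c.D i a = 0 := by
  refine c.eq_of_ε_eq fun l a => ?_
  rw [map_sum, map_zero]
  by_cases h : l = i
  · subst h
    simp_rw [ε_D_same]
    have : (n l : ℂ) + 1 ≠ 0 := by exact_mod_cast (n l).succ_ne_zero
    simp [this]
  · exact Finset.sum_eq_zero fun b _ => c.ε_D_of_ne h a b

/-- This expansion splits α(H) = 2 into contributions of the factors. -/
lemma sum_ε_smul_D [Fintype I] (h : t) : ∑ i, ∑ a, c.ε i a h • c.D i a = h := by
  refine c.eq_of_ε_eq fun l b => ?_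
  simp only [map_sum, map_smul, smul_eq_mul]
  rw [Finset.sum_eq_single l]
  · simp_rw [ε_D_same, mul_sub, Finset.sum_sub_distrib, ← Finset.sum_mul, sum_ε_apply]
    simp
  · intro i _ hi
    exact Finset.sum_eq_zero fun a _ => by rw [c.ε_D_of_ne hi.symm, mul_zero]
  · simp

lemma isSl2Triple (i : I) {a b : Fin (n i + 1)} (hab : a ≠ b) :
    IsSl2Triple ((c.D i a - c.D i b : t) : M) (c.unit i a b) (c.unit i b a) := by
  have h1 : ((c.D i a - c.D i b : t) : M) = ((c.unit i a a - c.unit i b b : g) : M) := rfl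
  have hba := hab.symm
  rw [h1]
  have hw : ∀ x y : Fin (n i + 1), ⁅c.unit i a a - c.unit i b b, c.unit i x y⁆ =
      (c.ε i x - c.ε i y) (c.D i a - c.D i b) • c.unit i x y := fun x y =>
    Subtype.ext (c.unit_mem_weightVectors i x y (c.D i a - c.D i b))
  refine ⟨fun h => ?_, ?_, ?_, ?_⟩
  · have h2 : c.D i a - c.D i b = 0 := Subtype.ext h
    have h3 := congrArg (c.ε i a) h2
    rw [map_sub, ε_D_same, ε_D_same] at h3
    simp [hab] at h3
  · have := c.lie_unit i a b b a
    simp only [if_true] at this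
    exact congrArg Subtype.val this
  · have := congrArg (Subtype.val : g → M) (hw a b)
    refine this.trans ?_
    have h2 : (c.ε i a - c.ε i b) (c.D i a - c.D i b) = (2 : ℕ) := by
      simp [ε_D_same, hab, hba]
      ring
    rw [h2, Nat.cast_smul_eq_nsmul]
    rfl
  · have := congrArg (Subtype.val : g → M) (hw b a)
    refine this.trans ?_
    have h2 : (c.ε i b - c.ε i a) (c.D i a - c.D i b) = -(2 : ℕ) := by
      simp [ε_D_same, hab, hba]
      ring
    rw [h2, neg_smul, Nat.cast_smul_eq_nsmul]
    rfl

end SLCoords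

end SLCoords

/-! ### Crystallographic bounds between roots of different algebras. -/

section Pairs

variable {V : Type*} [AddCommGroup V] [Module ℂ V] [FiniteDimensional ℂ V]
  {t : LieSubalgebra ℂ (Module.End ℂ V)}

local notation "tr" => LinearMap.trace ℂ V

lemma IsSl2Triple.exists_int_root_apply {H : t} {e f : Module.End ℂ V}
    (T : IsSl2Triple (H : Module.End ℂ V) e f) {x : Module.End ℂ V} {α : Module.Dual ℂ t}
    (hx : x ∈ weightVectors t α) (hx0 : x ≠ 0) : ∃ z : ℤ, α H = z :=
  T.exists_int_eq hx0 (hx H)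

/-- With p = tr(HH'), both w s' and z s equal 2p, so z w s s' = 4p². Strict Cauchy–Schwarz gives z w
< 4; equality makes H and H' proportional, and then the roots by duality. -/
lemma IsSl2Triple.exists_pairing [IsLieAbelian t]
    (hnil : ∀ h : t, (∀ χ : Weight ℂ t V, χ h = 0) → h = 0)
    {H H' : t} {e f e' f' : Module.End ℂ V} {α α' : Module.Dual ℂ t}
    (T : IsSl2Triple (H : Module.End ℂ V) e f) (T' : IsSl2Triple (H' : Module.End ℂ V) e' f')
    (he : e ∈ weightVectors t α) (he' : e' ∈ weightVectors t α') :
    ∃ s s' : ℝ, 0 < s ∧ 0 < s' ∧ tr ((H : Module.End ℂ V) * H) = s ∧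
      tr ((H' : Module.End ℂ V) * H') = s' ∧ ∃ z w : ℤ, α H' = z ∧ α' H = w ∧
      (w : ℝ) * s' = z * s ∧
      (z * w < 4 ∨ ∃ c : ℂ, c ≠ 0 ∧ H' = c • H ∧ α = c • α') := by
  obtain ⟨s, p, s', hs, hp, hs', hs0, hs'0, hsz, hsz', hdisc, hprop⟩ :=
    exists_real_trace_eq (H := H) (H' := H') T.exists_int_weight_eq T'.exists_int_weight_eq
  have hH0 : H ≠ 0 := fun h => T.h_ne_zero (by rw [h]; rfl)
  have hH'0 : H' ≠ 0 := fun h => T'.h_ne_zero (by rw [h]; rfl)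
  have hspos : 0 < s := hs0.lt_of_ne fun h => hH0 (hnil _ (hsz h.symm))
  have hs'pos : 0 < s' := hs'0.lt_of_ne fun h => hH'0 (hnil _ (hsz' h.symm))
  obtain ⟨z, hz⟩ := T'.exists_int_root_apply he T.e_ne_zero
  obtain ⟨w, hw⟩ := T.exists_int_root_apply he' T'.e_ne_zero
  have htr : ∀ h : t, 2 * tr ((h : Module.End ℂ V) * H) = α h * s := fun h => by
    rw [T.two_mul_trace_mul (he h), hs]
  have htr' : ∀ h : t, 2 * tr ((h : Module.End ℂ V) * H') = α' h * s' := fun h => by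
    rw [T'.two_mul_trace_mul (he' h), hs']
  have h1 : (z : ℝ) * s = 2 * p := by
    have := htr H'
    rw [LinearMap.trace_mul_comm, hp, hz] at this
    exact_mod_cast this.symm
  have h2 : (w : ℝ) * s' = 2 * p := by
    have := htr' H
    rw [hp, hw] at this
    exact_mod_cast this.symm
  refine ⟨s, s', hspos, hs'pos, hs, hs', z, w, hz, hw, by rw [h1, h2], ?_⟩
  have hzw : (z * w : ℝ) * (s * s') = 4 * p ^ 2 := by linear_combination w * s' * h1 + 2 * p * h2
  rcases eq_or_ne (s * s') (p ^ 2) with heq | hne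
  · right
    have h3 := hnil _ (hprop heq)
    have hsC : (s : ℂ) ≠ 0 := by exact_mod_cast hspos.ne'
    have h4 : H' = ((p : ℂ) / s) • H := by
      rw [sub_eq_zero] at h3
      rw [div_eq_inv_mul, mul_smul, ← h3, smul_smul, inv_mul_cancel₀ hsC, one_smul]
    have hp0 : p ≠ 0 := by
      rintro rfl
      exact hH'0 (by rw [h4]; simp)
    have hpC : (p : ℂ) ≠ 0 := by exact_mod_cast hp0
    refine ⟨_, div_ne_zero hpC hsC, h4, LinearMap.ext fun h => ?_⟩
    have h5 := htr h
    have h6 := htr' h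
    have h7 : tr ((h : Module.End ℂ V) * H') = (p : ℂ) / s * tr ((h : Module.End ℂ V) * H) := by
      have : ((((p : ℂ) / s) • H : t) : Module.End ℂ V) = ((p : ℂ) / s) • (H : Module.End ℂ V) :=
        rfl
      rw [h4, this, mul_smul_comm, map_smul, smul_eq_mul]
    have heqC : (s : ℂ) * s' = p ^ 2 := by exact_mod_cast heq
    rw [h7] at h6
    rw [LinearMap.smul_apply, smul_eq_mul]
    field_simp at h6 ⊢
    have h8 : (p : ℂ) * (α h * s) = (p : ℂ) * (α' h * p) := by
      linear_combination (-(p : ℂ)) * h5 + h6 + α' h * heqC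
    linear_combination mul_left_cancel₀ hpC h8
  · left
    have h3 : 0 < s * s' - p ^ 2 :=
      (nonneg_of_mul_nonneg_right hdisc hspos).lt_of_ne fun h => hne (sub_eq_zero.1 h.symm)
    have h4 : (z * w : ℝ) * (s * s') < 4 * (s * s') := by rw [hzw]; linarith
    have h5 := lt_of_mul_lt_mul_right h4 (mul_pos hspos hs'pos).le
    exact_mod_cast h5

end Pairs

/-! ### Roots of the second algebra are roots of the first. -/

namespace SLCoords

variable {V : Type*} [AddCommGroup V] [Module ℂ V]
  {t g : LieSubalgebra ℂ (Module.End ℂ V)} {I : Type*} [DecidableEq I] {n : I → ℕ}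
  (c : SLCoords t g n)

local notation "tr" => LinearMap.trace ℂ V

/-- Each of the two roots takes the value 1 on the other coroot, so both sides equal twice the trace
of the product of the coroots. -/
lemma trace_coroot_sq_eq_aux (i : I) {a b d : Fin (n i + 1)} (hab : a ≠ b) (had : a ≠ d) :
    tr (((c.D i a - c.D i b : t) : Module.End ℂ V) * (c.D i a - c.D i b : t)) =
      tr (((c.D i a - c.D i d : t) : Module.End ℂ V) * (c.D i a - c.D i d : t)) := by
  rcases eq_or_ne b d with rfl | hbd
  · rfl
  have h1 := (c.isSl2Triple i hab).two_mul_trace_mul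
    (c.unit_mem_weightVectors i a b (c.D i a - c.D i d))
  have h2 := (c.isSl2Triple i had).two_mul_trace_mul
    (c.unit_mem_weightVectors i a d (c.D i a - c.D i b))
  have e1 : (c.ε i a - c.ε i b) (c.D i a - c.D i d) = 1 := by
    simp [ε_D_same, hab.symm, had, hbd]
  have e2 : (c.ε i a - c.ε i d) (c.D i a - c.D i b) = 1 := by
    simp [ε_D_same, had.symm, hab, hbd.symm]
  rw [e1, one_mul] at h1
  rw [e2, one_mul] at h2
  rw [← h1, ← h2, LinearMap.trace_mul_comm]

lemma trace_coroot_sq_swap (i : I) (a b : Fin (n i + 1)) :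
    tr (((c.D i a - c.D i b : t) : Module.End ℂ V) * (c.D i a - c.D i b : t)) =
      tr (((c.D i b - c.D i a : t) : Module.End ℂ V) * (c.D i b - c.D i a : t)) := by
  have : ((c.D i b - c.D i a : t) : Module.End ℂ V) = -((c.D i a - c.D i b : t)) := by
    rw [← neg_sub]; rfl
  rw [this, neg_mul_neg]

lemma trace_coroot_sq_eq (i : I) {a b d e : Fin (n i + 1)} (hab : a ≠ b) (hde : d ≠ e) :
    tr (((c.D i a - c.D i b : t) : Module.End ℂ V) * (c.D i a - c.D i b : t)) =
      tr (((c.D i d - c.D i e : t) : Module.End ℂ V) * (c.D i d - c.D i e : t)) := by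
  rcases eq_or_ne a d with rfl | had
  · exact c.trace_coroot_sq_eq_aux i hab hde
  · rw [c.trace_coroot_sq_eq_aux i hab had, c.trace_coroot_sq_swap,
      c.trace_coroot_sq_eq_aux i had.symm hde]

/-- The contribution of one factor to the Casimir identity for the squared length of a coroot. -/
lemma sum_sum_sub_mul_sub (i : I) (h : t) (α : Module.Dual ℂ t) :
    ∑ a, ∑ b, α (c.D i a - c.D i b) * (c.ε i a h - c.ε i b h) =
      2 * ((n i : ℂ) + 1) * ∑ a, c.ε i a h * α (c.D i a) := by
  have hD : ∑ a, α (c.D i a) = 0 := by rw [← map_sum, c.sum_D, map_zero]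
  have h1 : ∀ a b, α (c.D i a - c.D i b) * (c.ε i a h - c.ε i b h) =
      c.ε i a h * α (c.D i a) + c.ε i b h * α (c.D i b) - α (c.D i a) * c.ε i b h -
        α (c.D i b) * c.ε i a h := fun a b => by rw [map_sub]; ring
  have h2 : ∑ a, ∑ _b : Fin (n i + 1), c.ε i a h * α (c.D i a) =
      ((n i : ℂ) + 1) * ∑ a, c.ε i a h * α (c.D i a) := by
    simp [Finset.mul_sum]
  have h3 : ∑ _a : Fin (n i + 1), ∑ b, c.ε i b h * α (c.D i b) =
      ((n i : ℂ) + 1) * ∑ a, c.ε i a h * α (c.D i a) := by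
    simp
  simp_rw [h1, Finset.sum_sub_distrib, Finset.sum_add_distrib, h2, h3, ← Finset.mul_sum,
    ← Finset.sum_mul, sum_ε_apply, hD, mul_zero, zero_mul,
    Finset.sum_const_zero]
  ring

variable [FiniteDimensional ℂ V]

/-- All coroots of the factor have the same squared length s, so τ = s / tr(H²) satisfies α(D_a -
D_b) = τ (z_a - z_b) for every pair, where z_a = ε_a(H) - ε_0(H). The bounds leave at most two
values of z; j counts the indices at one of them, with j = 0 if z is constant, and N is τ times the
square of the gap. -/
lemma exists_contribution [IsLieAbelian t]
    (hnil : ∀ h : t, (∀ χ : Weight ℂ t V, χ h = 0) → h = 0)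
    {H : t} {e f : Module.End ℂ V} {α : Module.Dual ℂ t}
    (T : IsSl2Triple (H : Module.End ℂ V) e f) (he : e ∈ weightVectors t α)
    (i : I) (hn : 1 ≤ n i)
    (hprop : ∀ a b, a ≠ b → ¬ ∃ z : ℂ, z ≠ 0 ∧ H = z • (c.D i a - c.D i b) ∧
      c.ε i a - c.ε i b = z • α) :
    ∃ N j : ℕ, 1 ≤ N ∧ N ≤ 3 ∧ j ≤ n i + 1 ∧
      ∑ a, c.ε i a H * α (c.D i a) = (((N * (j * (n i + 1 - j)) : ℕ) : ℝ) / (n i + 1 : ℕ) : ℝ) := by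
  have hpair := fun a b (hab : a ≠ b) => (c.isSl2Triple i hab).exists_pairing hnil T
    (c.unit_mem_weightVectors i a b) he
  have h01 : (0 : Fin (n i + 1)) ≠ Fin.last _ := by
    rw [Ne, Fin.ext_iff]
    simp
    omega
  obtain ⟨s, s', hs, hs', htr, htr', -⟩ := hpair 0 (Fin.last _) h01
  have hz : ∀ a, ∃ z : ℤ, c.ε i a H - c.ε i 0 H = z := fun a => by
    rcases eq_or_ne a 0 with rfl | h
    · exact ⟨0, by simp⟩
    · obtain ⟨_, _, -, -, -, -, z, -, hz, -⟩ := hpair a 0 h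
      exact ⟨z, hz⟩
  choose z hz using hz
  have hzz : ∀ a b, c.ε i a H - c.ε i b H = ((z a - z b : ℤ) : ℂ) := fun a b => by
    push_cast
    rw [← hz, ← hz]
    ring
  have hw : ∀ a b, ∃ w : ℤ, (s / s') * ((z a - z b : ℤ) : ℝ) = w ∧
      α (c.D i a - c.D i b) = w ∧ (z a - z b) * w < 4 := by
    intro a b
    rcases eq_or_ne a b with rfl | hab
    · exact ⟨0, by simp⟩
    · obtain ⟨s₁, s₁', -, -, hs₁, hs₁', z', w, hz', hw, hrel, hlt⟩ := hpair a b hab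
      rw [c.trace_coroot_sq_eq i hab h01, htr] at hs₁
      rw [htr'] at hs₁'
      have e1 : s = s₁ := by exact_mod_cast hs₁
      have e2 : s' = s₁' := by exact_mod_cast hs₁'
      rw [LinearMap.sub_apply, hzz] at hz'
      have e3 : z a - z b = z' := by exact_mod_cast hz'
      subst e1 e2 e3
      refine ⟨w, ?_, hw, hlt.resolve_right (hprop a b hab)⟩
      rw [div_mul_eq_mul_div, div_eq_iff hs'.ne', hrel]
      ring
  have hval : ∀ a b, (α (c.D i a - c.D i b)) * (c.ε i a H - c.ε i b H) =
      ((s / s' * ((z a - z b : ℤ) : ℝ) ^ 2 : ℝ) : ℂ) := by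
    intro a b
    obtain ⟨w, h1, h2, -⟩ := hw a b
    rw [h2, hzz, sq, ← mul_assoc, h1]
    push_cast
    ring
  obtain ⟨N, hN1, hN3, S, hS⟩ := exists_finset_forall_sub_sq_eq z (div_pos hs hs')
    (fun a b => (hw a b).imp fun w h => h.1) (fun a b => by
      obtain ⟨w, h1, -, h3⟩ := hw a b
      rw [sq, ← mul_assoc, h1]
      rw [mul_comm] at h3
      exact_mod_cast h3)
  refine ⟨N, S.card, hN1, hN3, by simpa using S.card_le_univ, ?_⟩
  have h1 := c.sum_sum_sub_mul_sub i H α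
  simp_rw [hval, hS, ← Complex.ofReal_sum, ← Finset.mul_sum, sum_sum_indicator_sub_sq] at h1
  rw [Fintype.card_fin] at h1
  have hn0 : (n i : ℂ) + 1 ≠ 0 := by exact_mod_cast (n i).succ_ne_zero
  have h2 : (2 : ℂ) * (((n i : ℂ) + 1) * ∑ a, c.ε i a H * α (c.D i a)) =
      2 * (N * (S.card * (n i + 1 - S.card) : ℕ)) := by
    rw [← mul_assoc, ← h1]
    push_cast
    ring
  have h3 := mul_left_cancel₀ two_ne_zero h2
  rw [Complex.ofReal_div, Complex.ofReal_natCast, Complex.ofReal_natCast, Nat.cast_mul, ← h3,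
    Nat.cast_add, Nat.cast_one, mul_div_cancel_left₀ _ hn0]

/-- Every root attached to an `sl₂`-triple of weight vectors for `t` is a root of `g`, with the same
coroot. -/
lemma exists_eq_sub [Fintype I] [IsLieAbelian t]
    (hnil : ∀ h : t, (∀ χ : Weight ℂ t V, χ h = 0) → h = 0)
    (hn : ∀ i, n i ∉ ({0, 1, 2, 3, 5, 7, 8} : Set ℕ)) (h4 : ∀ i l, n i = 4 → n l = 4 → i = l)
    {H : t} {e f : Module.End ℂ V} {α : Module.Dual ℂ t}
    (T : IsSl2Triple (H : Module.End ℂ V) e f) (he : e ∈ weightVectors t α) :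
    ∃ i a b, a ≠ b ∧ α = c.ε i a - c.ε i b ∧ H = c.D i a - c.D i b := by
  have hn2 : ∀ i, 2 ≤ n i := fun i => by
    have := hn i
    simp only [Set.mem_insert_iff, Set.mem_singleton_iff, not_or] at this
    omega
  have hαH : α H = 2 := by
    have h1 := he H
    rw [T.lie_h_e_smul ℂ] at h1
    exact (smul_left_injective ℂ T.e_ne_zero h1).symm
  by_cases hall : ∀ i a b, a ≠ b → ¬ ∃ z : ℂ, z ≠ 0 ∧ H = z • (c.D i a - c.D i b) ∧
      c.ε i a - c.ε i b = z • α
  · exfalso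
    choose N j hN hN3 hj hsum using fun i =>
      c.exists_contribution hnil T he i (by have := hn2 i; omega) (hall i)
    have htot : ∑ i, ∑ a, c.ε i a H * α (c.D i a) = 2 := by
      rw [← hαH]
      conv_rhs => rw [← c.sum_ε_smul_D H]
      simp only [map_sum, map_smul, smul_eq_mul]
    simp_rw [hsum, ← Complex.ofReal_sum] at htot
    refine sum_mul_mul_sub_div_ne_two (fun i => n i + 1) N j (fun i => ?_) (fun i => by omega)
      (fun i l hi hl => h4 i l (by omega) (by omega)) hN hN3 hj (by exact_mod_cast htot)
    have := hn i
    simp only [Set.mem_insert_iff, Set.mem_singleton_iff, not_or] at this ⊢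
    omega
  · push Not at hall
    obtain ⟨i, a, b, hab, z, hz0, hHz, hαz⟩ := hall
    -- The root with indices a and a third index d pairs to 1 with that of a and b, so integrality
    -- of its pairings with α makes both z and its inverse integers.
    obtain ⟨d, hd⟩ : ∃ d : Fin (n i + 1), d ∉ ({a, b} : Finset (Fin (n i + 1))) := by
      by_contra! h
      have h1 := Finset.card_le_two (a := a) (b := b)
      have h2 := hn2 i
      rw [Finset.eq_univ_iff_forall.2 h, Finset.card_univ, Fintype.card_fin] at h1
      omega
    simp only [Finset.mem_insert, Finset.mem_singleton, not_or] at hd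
    obtain ⟨x, hx⟩ := T.exists_int_root_apply (c.unit_mem_weightVectors i a d)
      (c.isSl2Triple i (Ne.symm hd.1)).e_ne_zero
    obtain ⟨y, hy⟩ := (c.isSl2Triple i (Ne.symm hd.1)).exists_int_root_apply he T.e_ne_zero
    have hx' : z = x := by
      rw [← hx, hHz]
      simp [ε_D_same, hab, hd.1, hd.2]
    have hy' : z * y = 1 := by
      have h1 := LinearMap.congr_fun hαz (c.D i a - c.D i d)
      rw [LinearMap.smul_apply, hy, smul_eq_mul] at h1
      rw [← h1]
      simp [ε_D_same, hab.symm, Ne.symm hd.1, Ne.symm hd.2]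
    have hxy : x * y = 1 := by
      rw [hx'] at hy'
      exact_mod_cast hy'
    rcases Int.isUnit_iff.1 (IsUnit.of_mul_eq_one _ hxy) with rfl | rfl
    · refine ⟨i, a, b, hab, ?_, ?_⟩
      · rw [hαz, hx']; simp
      · rw [hHz, hx']; simp
    · refine ⟨i, b, a, hab.symm, ?_, ?_⟩
      · rw [← neg_sub, hαz, hx']; simp
      · rw [hHz, hx']; simp

end SLCoords

/-! ### Equality of the two root systems. -/

namespace SLCoords

variable {M : Type*} [LieRing M] [LieAlgebra ℂ M] {t g : LieSubalgebra ℂ M}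
  {I : Type*} [DecidableEq I] {n : I → ℕ} (c : SLCoords t g n)

/-- Type A is simply laced: a root reaches the value 2 only on its own coroot. Uniqueness of coroots
and vanishing of brackets both rest on this. -/
lemma root_apply_coroot_le (i : I) {a b : Fin (n i + 1)} (hab : a ≠ b) (l : I)
    (x y : Fin (n l + 1)) (hxy : x ≠ y) :
    (∃ k : ℤ, k ≤ 1 ∧ (c.ε l x - c.ε l y) (c.D i a - c.D i b) = k) ∨
      ((c.ε l x - c.ε l y) (c.D i a - c.D i b) = 2 ∧ c.ε l x - c.ε l y = c.ε i a - c.ε i b ∧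
        c.D l x - c.D l y = c.D i a - c.D i b) := by
  by_cases hl : l = i
  · subst hl
    by_cases h : x = a ∧ y = b
    · right
      obtain ⟨rfl, rfl⟩ := h
      refine ⟨?_, rfl, rfl⟩
      simp [ε_D_same, hxy, hxy.symm]
      ring
    · left
      refine ⟨(if x = a then 1 else 0) - (if x = b then 1 else 0) -
        ((if y = a then 1 else 0) - (if y = b then 1 else 0)), ?_, ?_⟩
      · split_ifs <;> simp_all
      · simp only [LinearMap.sub_apply, map_sub, ε_D_same]
        push_cast
        ring
  · left
    exact ⟨0, by norm_num, by simp [c.ε_D_of_ne hl]⟩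

lemma coroot_eq_of_root_eq {i l : I} {a b : Fin (n i + 1)} (hab : a ≠ b) {x y : Fin (n l + 1)}
    (hxy : x ≠ y) (h : c.ε i a - c.ε i b = c.ε l x - c.ε l y) :
    c.D i a - c.D i b = c.D l x - c.D l y := by
  rcases c.root_apply_coroot_le i hab l x y hxy with ⟨k, hk, h1⟩ | ⟨-, -, h1⟩
  · have h2 : (c.ε i a - c.ε i b) (c.D i a - c.D i b) = 2 := by
      simp [ε_D_same, hab, hab.symm]
      ring
    rw [← h, h2] at h1
    have : (2 : ℤ) = k := by exact_mod_cast h1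
    omega
  · exact h1.symm

lemma root_ne_zero (i : I) {a b : Fin (n i + 1)} (hab : a ≠ b) : c.ε i a - c.ε i b ≠ 0 := by
  intro h
  have h2 : (c.ε i a - c.ε i b) (c.D i a - c.D i b) = 2 := by
    simp [ε_D_same, hab, hab.symm]
    ring
  simp [h] at h2

variable [FiniteDimensional ℂ M] {g' : LieSubalgebra ℂ M}

/-- The roots of `g'` are roots of `g`, with the same coroots. -/
def RootsLE (c : SLCoords t g n) (g' : LieSubalgebra ℂ M) : Prop :=
  ∀ α ∈ rootSet t g', ∀ (H : t) (e f : M), IsSl2Triple (H : M) e f → e ∈ weightVectors t α →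
    ∃ i a b, a ≠ b ∧ α = c.ε i a - c.ε i b ∧ H = c.D i a - c.D i b

variable [IsKilling ℂ g'] {c}

lemma RootsLE.exists_eq (hR : c.RootsLE g') (ht' : IsCartanIn t g') {α : Module.Dual ℂ t}
    (hα : α ∈ rootSet t g') : ∃ i a b, a ≠ b ∧ α = c.ε i a - c.ε i b := by
  obtain ⟨H, e, f, T, -, -, he, -⟩ := exists_isSl2Triple_of_mem_rootSet ht' hα
  obtain ⟨i, a, b, hab, h, -⟩ := hR α hα H e f T he
  exact ⟨i, a, b, hab, h⟩

lemma RootsLE.exists_isSl2Triple (hR : c.RootsLE g') (ht' : IsCartanIn t g') {i : I}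
    {a b : Fin (n i + 1)} (hab : a ≠ b) (hα : c.ε i a - c.ε i b ∈ rootSet t g') :
    ∃ e f : M, IsSl2Triple ((c.D i a - c.D i b : t) : M) e f ∧ e ∈ g' ∧ f ∈ g' ∧
      e ∈ weightVectors t (c.ε i a - c.ε i b) ∧ f ∈ weightVectors t (c.ε i b - c.ε i a) := by
  obtain ⟨H, e, f, T, heg, hfg, he, hf, -⟩ := exists_isSl2Triple_of_mem_rootSet ht' hα
  obtain ⟨l, x, y, hxy, h1, rfl⟩ := hR _ hα H e f T he
  rw [neg_sub] at hf
  exact ⟨e, f, by rwa [c.coroot_eq_of_root_eq hab hxy h1], heg, hfg, he, hf⟩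

lemma RootsLE.neg_mem (hR : c.RootsLE g') (ht' : IsCartanIn t g') {i : I}
    {a b : Fin (n i + 1)} (hab : a ≠ b) (hα : c.ε i a - c.ε i b ∈ rootSet t g') :
    c.ε i b - c.ε i a ∈ rootSet t g' := by
  obtain ⟨e, f, T, heg, hfg, he, hf⟩ := hR.exists_isSl2Triple ht' hab hα
  exact ⟨c.root_ne_zero i hab.symm, f, hfg, T.f_ne_zero, hf⟩

/-- If ⁅e, x⁆ vanished, x would be a primitive vector with eigenvalue -1, which is not a natural
number. -/
lemma RootsLE.add_mem (hR : c.RootsLE g') (ht' : IsCartanIn t g') {i : I}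
    {a b d : Fin (n i + 1)} (hab : a ≠ b) (hbd : b ≠ d) (had : a ≠ d)
    (hα : c.ε i a - c.ε i b ∈ rootSet t g') (hβ : c.ε i b - c.ε i d ∈ rootSet t g') :
    c.ε i a - c.ε i d ∈ rootSet t g' := by
  obtain ⟨e, f, T, heg, hfg, he, hf⟩ := hR.exists_isSl2Triple ht' hab hα
  obtain ⟨-, x, hxg, hx0, hx⟩ := hβ
  have hex := lie_mem_weightVectors he hx
  rw [sub_add_sub_cancel] at hex
  refine ⟨c.root_ne_zero i had, ⁅e, x⁆, g'.lie_mem heg hxg, fun h0 => ?_, hex⟩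
  have h1 : (c.ε i b - c.ε i d) (c.D i a - c.D i b) = -1 := by
    simp [ε_D_same, hab.symm, had.symm, hbd.symm]
    ring
  have P : T.HasPrimitiveVectorWith x (-1 : ℂ) := ⟨hx0, by rw [← h1]; exact hx _, h0⟩
  obtain ⟨k, hk⟩ := P.exists_nat
  have : (-1 : ℤ) = k := by exact_mod_cast hk
  omega

/-- The roots of `g` are roots of `g'`. -/
lemma RootsLE.mem_rootSet (hR : c.RootsLE g') (ht' : IsCartanIn t g') {i : I}
    {a d : Fin (n i + 1)} (had : a ≠ d) : c.ε i a - c.ε i d ∈ rootSet t g' := by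
  classical
  by_contra hd
  -- The connected component of a in the graph on indices whose edges are roots of `g'`.
  let S : Finset (Fin (n i + 1)) :=
    Finset.univ.filter fun b => b = a ∨ c.ε i a - c.ε i b ∈ rootSet t g'
  have hS : ∀ b, b ∈ S ↔ b = a ∨ c.ε i a - c.ε i b ∈ rootSet t g' := fun b => by simp [S]
  have hstep : ∀ x y, x ≠ y → c.ε i x - c.ε i y ∈ rootSet t g' → x ∈ S → y ∈ S := by
    intro x y hxy hr hx
    rw [hS] at hx ⊢
    by_cases hya : y = a
    · exact Or.inl hya
    right
    rcases hx with rfl | hx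
    · exact hr
    · by_cases hxa : x = a
      · subst hxa
        exact hr
      · exact hR.add_mem ht' (Ne.symm hxa) hxy (Ne.symm hya) hx hr
  have hε : ∀ x, c.ε i x (∑ b ∈ S, c.D i b) =
      (if x ∈ S then 1 else 0) - S.card * ((n i : ℂ) + 1)⁻¹ := fun x => by
    simp [map_sum, ε_D_same, Finset.sum_sub_distrib]
  -- No root of `g'` joins S to its complement, so all of them vanish on this sum. Yet the
  -- coordinates at a and d differ by 1 on it.
  have h0 : ∑ b ∈ S, c.D i b = 0 := by
    refine eq_zero_of_forall_root_apply_eq_zero ht' fun α hα => ?_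
    obtain ⟨l, x, y, hxy, rfl⟩ := hR.exists_eq ht' hα
    by_cases hl : l = i
    · subst hl
      have : x ∈ S ↔ y ∈ S := ⟨hstep x y hxy hα, hstep y x hxy.symm (hR.neg_mem ht' hxy hα)⟩
      rw [LinearMap.sub_apply, hε, hε]
      simp [this]
    · rw [map_sum]
      exact Finset.sum_eq_zero fun b _ => by simp [c.ε_D_of_ne hl]
  have ha := hε a
  have hd' := hε d
  have haS : a ∈ S := (hS a).2 (Or.inl rfl)
  have hdS : d ∉ S := fun h => ((hS d).1 h).elim (fun h => had h.symm) hd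
  rw [h0, map_zero, if_pos haS] at ha
  rw [h0, map_zero, if_neg hdS] at hd'
  have : (0 : ℂ) = 1 := by linear_combination ha - hd'
  exact zero_ne_one this

/-- The sum of the two weights takes the value 2 + k ≥ 2 on the first coroot, so as a root it could
only equal the first weight, making the second zero. -/
lemma RootsLE.lie_eq_zero (hR : c.RootsLE g') (ht' : IsCartanIn t g') {i l : I}
    {a b : Fin (n i + 1)} {x y : Fin (n l + 1)} (hab : a ≠ b) (hxy : x ≠ y) {k : ℕ}
    (hk : (c.ε l x - c.ε l y) (c.D i a - c.D i b) = k) {v w : M} (hvg : v ∈ g') (hwg : w ∈ g')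
    (hv : v ∈ weightVectors t (c.ε i a - c.ε i b)) (hw : w ∈ weightVectors t (c.ε l x - c.ε l y)) :
    ⁅v, w⁆ = 0 := by
  have h2 : (c.ε i a - c.ε i b) (c.D i a - c.D i b) = 2 := by
    simp [ε_D_same, hab, hab.symm]
    ring
  have hval : (c.ε i a - c.ε i b + (c.ε l x - c.ε l y)) (c.D i a - c.D i b) = 2 + k := by
    rw [LinearMap.add_apply, h2, hk]
  refine lie_eq_zero_of_notMem_rootSet hvg hwg hv hw (fun h => ?_) fun h => ?_
  · rw [h, LinearMap.zero_apply] at hval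
    have : (0 : ℤ) = 2 + k := by exact_mod_cast hval
    omega
  · obtain ⟨j, p, q, hpq, h3⟩ := hR.exists_eq ht' h
    rcases c.root_apply_coroot_le i hab j p q hpq with ⟨m, hm, h4⟩ | ⟨-, h4, -⟩
    · rw [← h3, hval] at h4
      have : (2 : ℤ) + k = m := by exact_mod_cast h4
      omega
    · rw [← h3, add_eq_left] at h4
      exact c.root_ne_zero l hxy h4

end SLCoords

/-! ### The isomorphism theorem by matrix units. -/

namespace SLCoords

variable {M : Type*} [LieRing M] [LieAlgebra ℂ M] {t g : LieSubalgebra ℂ M}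
  {I : Type*} [DecidableEq I] {n : I → ℕ} {c : SLCoords t g n}

lemma sum_coord_smul_unit [Fintype I] (c : SLCoords t g n) (x : g) :
    ∑ i, ∑ a, ∑ b, c.coord i x a b • c.unit i a b = x := by
  refine c.ext_coord fun l => ?_
  simp only [map_sum, map_smul]
  rw [Finset.sum_eq_single l]
  · simp_rw [coord_unit_same]
    exact sum_smul_tracelessUnit (c.trace_coord l x)
  · intro i _ hi
    exact Finset.sum_eq_zero fun a _ => Finset.sum_eq_zero fun b _ => by
      rw [c.coord_unit_of_ne hi.symm, smul_zero]
  · simp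

lemma lie_unit_of_ne (c : SLCoords t g n) {i l : I} (hil : i ≠ l) (a b x y) :
    ⁅c.unit i a b, c.unit l x y⁆ = 0 := by
  refine c.ext_coord fun j => ?_
  rw [LieHom.map_lie, map_zero]
  by_cases h : j = i
  · subst h
    rw [c.coord_unit_of_ne hil, lie_zero]
  · rw [c.coord_unit_of_ne h, zero_lie]

lemma single_lie_lie_single {m : Type*} [Fintype m] [DecidableEq m] (A : Matrix m m ℂ) {a b : m}
    (hab : a ≠ b) : ⁅tracelessUnit b a, ⁅A, tracelessUnit b a⁆⁆ =
      (2 * A a b) • (tracelessUnit b a : Matrix m m ℂ) := by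
  have h1 : (Matrix.single b a (1 : ℂ) * Matrix.single b a 1 : Matrix m m ℂ) = 0 := by
    simp [hab]
  have h2 : (Matrix.single b a (1 : ℂ) * A * Matrix.single b a 1 : Matrix m m ℂ) =
      A a b • Matrix.single b a 1 := by
    rw [Matrix.single_mul_mul_single]
    simp [Matrix.smul_single]
  simp only [tracelessUnit, hab.symm, if_false, zero_smul, sub_zero, Ring.lie_def, mul_sub, sub_mul]
  rw [← mul_assoc, h2, ← mul_assoc, h1, mul_assoc A, h1, zero_mul, mul_zero]
  module

variable [FiniteDimensional ℂ M] {g' : LieSubalgebra ℂ M} [IsKilling ℂ g']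

/-- Matrix units for one factor, built inside `g'`. -/
structure UnitsIn (c : SLCoords t g n) (g' : LieSubalgebra ℂ M) (i : I) where
  u : Fin (n i + 1) → Fin (n i + 1) → M
  u_mem (a b) : u a b ∈ g'
  u_self (a) : u a a = c.D i a
  u_mem_weightVectors (a b) : u a b ∈ weightVectors t (c.ε i a - c.ε i b)
  u_ne_zero {a b} : a ≠ b → u a b ≠ 0
  lie_u (a b x y) : ⁅u a b, u x y⁆ = (if b = x then u a y else 0) - (if y = a then u x b else 0)

/-- Only the triples joining an index to 0 are free choices; the other units are their brackets, so
no signs have to be matched. All relations follow from the Jacobi identity, the triples and the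
vanishing brackets. -/
lemma lie_of_mem_weightVectors_zero_row (hR : c.RootsLE g') (ht' : IsCartanIn t g') (i : I)
    (u : Fin (n i + 1) → Fin (n i + 1) → M)
    (hu : ∀ a b, u a b ∈ g') (hself : ∀ a, u a a = c.D i a)
    (hw : ∀ a b, u a b ∈ weightVectors t (c.ε i a - c.ε i b))
    (htriple : ∀ a, a ≠ 0 → ⁅u a 0, u 0 a⁆ = u a a - u 0 0)
    (hdef : ∀ a b, a ≠ 0 → b ≠ 0 → a ≠ b → ⁅u a 0, u 0 b⁆ = u a b) (a b x y) :
    ⁅u a b, u x y⁆ = (if b = x then u a y else 0) - (if y = a then u x b else 0) := by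
  have hdiag : ∀ a x y, ⁅u a a, u x y⁆ =
      ((if x = a then 1 else 0) - (if y = a then 1 else 0) : ℂ) • u x y := fun a x y => by
    rw [hself, hw x y]
    simp [ε_D_same]
  have hvan : ∀ a b x y, a ≠ b → x ≠ y → b ≠ x → y ≠ a → ⁅u a b, u x y⁆ = 0 := by
    intro a b x y hab hxy hbx hya
    -- Since b ≠ x and y ≠ a, only nonnegative terms survive in the pairing.
    refine hR.lie_eq_zero ht' hab hxy (k := (if x = a then 1 else 0) + (if y = b then 1 else 0))
      ?_ (hu _ _) (hu _ _) (hw _ _) (hw _ _)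
    simp only [LinearMap.sub_apply, map_sub, ε_D_same, hbx.symm, hya, if_false]
    push_cast
    ring
  have htriple' : ∀ a, a ≠ 0 → ⁅u 0 a, u a 0⁆ = u 0 0 - u a a := fun a ha => by
    rw [← lie_skew, htriple a ha, neg_sub]
  have hleft : ∀ b d, b ≠ 0 → d ≠ 0 → b ≠ d → ⁅u 0 b, u b d⁆ = u 0 d := by
    intro b d hb hd hbd
    rw [← hdef b d hb hd hbd, leibniz_lie, htriple' b hb, sub_lie, hdiag, hdiag,
      hvan 0 b 0 d hb.symm hd.symm hb hd]
    simp [hb.symm, hbd.symm, hd]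
  have hright : ∀ a b, a ≠ 0 → b ≠ 0 → a ≠ b → ⁅u a b, u b 0⁆ = u a 0 := by
    intro a b ha hb hab
    rw [← hdef a b ha hb hab, lie_lie, hvan a 0 b 0 ha hb hb.symm ha.symm, lie_zero, sub_zero,
      htriple' b hb, lie_sub, ← lie_skew (u a 0) (u 0 0), ← lie_skew (u a 0) (u b b), hdiag, hdiag]
    simp [ha, hab, hb.symm]
  have hcomp : ∀ a b d, a ≠ b → b ≠ d → a ≠ d → ⁅u a b, u b d⁆ = u a d := by
    intro a b d hab hbd had
    by_cases hb : b = 0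
    · subst hb
      exact hdef a d hab hbd.symm had
    by_cases ha : a = 0
    · subst ha
      exact hleft b d hb had.symm hbd
    by_cases hd : d = 0
    · subst hd
      exact hright a b ha hb hab
    rw [← hdef b d hb hd hbd, leibniz_lie, hright a b ha hb hab, hdef a d ha hd had,
      hvan a b 0 d hab (Ne.symm hd) hb had.symm, lie_zero, add_zero]
  have hopp : ∀ a b, a ≠ b → ⁅u a b, u b a⁆ = u a a - u b b := by
    intro a b hab
    by_cases hb : b = 0
    · subst hb
      exact htriple a hab
    by_cases ha : a = 0
    · subst ha
      rw [← lie_skew, htriple b hb, neg_sub]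
    rw [← hdef b a hb ha hab.symm, leibniz_lie, hright a b ha hb hab, htriple a ha,
      ← lie_skew (u a b) (u 0 a), hleft a b ha hb hab, lie_neg, htriple b hb]
    abel
  by_cases hab : a = b
  · subst hab
    rw [hdiag, sub_smul]
    congr 1
    · by_cases h : x = a
      · subst h; simp
      · simp [h, Ne.symm h]
    · by_cases h : y = a
      · subst h; simp
      · simp [h]
  by_cases hxy : x = y
  · subst hxy
    rw [← lie_skew, hdiag, sub_smul, neg_sub]
    congr 1
    · by_cases h : b = x
      · subst h; simp
      · simp [h]
    · by_cases h : x = a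
      · subst h; simp
      · simp [h, Ne.symm h]
  by_cases hbx : b = x
  · subst hbx
    by_cases hya : y = a
    · subst hya
      simp [hopp y b hab]
    · simp [hya, hcomp a b y hab hxy (Ne.symm hya)]
  · by_cases hya : y = a
    · subst hya
      rw [← lie_skew, hcomp x y b hxy hab (Ne.symm hbx)]
      simp [hbx]
    · simp [hbx, hya, hvan a b x y hab hxy hbx hya]

lemma RootsLE.nonempty_unitsIn (hR : c.RootsLE g') (ht' : IsCartanIn t g') (i : I) :
    Nonempty (c.UnitsIn g' i) := by
  have htri : ∀ a : Fin (n i + 1), ∃ e f : M, a ≠ 0 →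
      IsSl2Triple ((c.D i a - c.D i 0 : t) : M) e f ∧ e ∈ g' ∧ f ∈ g' ∧
      e ∈ weightVectors t (c.ε i a - c.ε i 0) ∧ f ∈ weightVectors t (c.ε i 0 - c.ε i a) := by
    intro a
    by_cases ha : a = 0
    · exact ⟨0, 0, fun h => absurd ha h⟩
    · obtain ⟨e, f, h⟩ := hR.exists_isSl2Triple ht' ha (hR.mem_rootSet ht' ha)
      exact ⟨e, f, fun _ => h⟩
  choose p m hpm using htri
  let u : Fin (n i + 1) → Fin (n i + 1) → M := fun a b =>
    if a = b then c.D i a else if b = 0 then p a else if a = 0 then m b else ⁅p a, m b⁆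
  have hself : ∀ a, u a a = c.D i a := fun a => by simp [u]
  have hp : ∀ a, a ≠ 0 → u a 0 = p a := fun a ha => by simp [u, ha]
  have hm : ∀ a, a ≠ 0 → u 0 a = m a := fun a ha => by simp [u, ha, ha.symm]
  have hdef : ∀ a b, a ≠ 0 → b ≠ 0 → a ≠ b → u a b = ⁅p a, m b⁆ := fun a b ha hb hab => by
    simp [u, ha, hb, hab]
  have hu : ∀ a b, u a b ∈ g' := by
    intro a b
    by_cases hab : a = b
    · subst hab
      rw [hself]
      exact ht'.1 (c.D i a).2
    by_cases hb : b = 0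
    · subst hb
      rw [hp a hab]
      exact (hpm a hab).2.1
    by_cases ha : a = 0
    · subst ha
      rw [hm b hb]
      exact (hpm b hb).2.2.1
    rw [hdef a b ha hb hab]
    exact g'.lie_mem (hpm a ha).2.1 (hpm b hb).2.2.1
  have hw : ∀ a b, u a b ∈ weightVectors t (c.ε i a - c.ε i b) := by
    intro a b
    by_cases hab : a = b
    · subst hab
      rw [hself, sub_self]
      intro h
      rw [lie_eq_zero_of_isCartanIn ht']
      simp
    by_cases hb : b = 0
    · subst hb
      rw [hp a hab]
      exact (hpm a hab).2.2.2.1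
    by_cases ha : a = 0
    · subst ha
      rw [hm b hb]
      exact (hpm b hb).2.2.2.2
    rw [hdef a b ha hb hab, ← sub_add_sub_cancel _ (c.ε i 0)]
    exact lie_mem_weightVectors (hpm a ha).2.2.2.1 (hpm b hb).2.2.2.2
  have hlie := lie_of_mem_weightVectors_zero_row hR ht' i u hu hself hw
    (fun a ha => by
      rw [hp a ha, hm a ha, (hpm a ha).1.lie_e_f, hself, hself]
      rfl)
    (fun a b ha hb hab => by rw [hp a ha, hm b hb, hdef a b ha hb hab])
  refine ⟨⟨u, hu, hself, hw, fun {a b} hab h0 => ?_, hlie⟩⟩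
  have h1 := hlie a b b a
  rw [h0, zero_lie, if_pos rfl, if_pos rfl, hself, hself, eq_comm, sub_eq_zero] at h1
  have h2 := congrArg (c.ε i a) (Subtype.ext h1)
  rw [ε_D_same, ε_D_same] at h2
  simp [hab] at h2

lemma RootsLE.lie_u_of_ne (hR : c.RootsLE g') (ht' : IsCartanIn t g') {i l : I} (hil : i ≠ l)
    (U : c.UnitsIn g' i) (U' : c.UnitsIn g' l) (a b x y) : ⁅U.u a b, U'.u x y⁆ = 0 := by
  by_cases hab : a = b
  · subst hab
    rw [U.u_self, U'.u_mem_weightVectors x y]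
    simp [c.ε_D_of_ne hil.symm]
  by_cases hxy : x = y
  · subst hxy
    rw [U'.u_self, ← lie_skew, U.u_mem_weightVectors a b]
    simp [c.ε_D_of_ne hil]
  exact hR.lie_eq_zero ht' hab hxy (k := 0) (by simp [c.ε_D_of_ne hil.symm]) (U.u_mem _ _)
    (U'.u_mem _ _) (U.u_mem_weightVectors _ _) (U'.u_mem_weightVectors _ _)

/-- The isomorphism theorem: if the roots and coroots of `g'` are among those of `g`, the identity
of `t` extends to an isomorphism. -/
theorem RootsLE.exists_lieEquiv [Fintype I] (hR : c.RootsLE g') (ht' : IsCartanIn t g') :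
    ∃ ψ : g ≃ₗ⁅ℂ⁆ g', ∀ h : t, (ψ ⟨h, c.le h.2⟩ : M) = h := by
  have U := fun i => (hR.nonempty_unitsIn ht' i).some
  let φ : g →ₗ[ℂ] M :=
    { toFun := fun x => ∑ i, ∑ a, ∑ b, c.coord i x a b • (U i).u a b
      map_add' := fun x y => by simp [add_smul, Finset.sum_add_distrib]
      map_smul' := fun z x => by simp [mul_smul, Finset.smul_sum] }
  have hφ : ∀ x, φ x = ∑ i, ∑ a, ∑ b, c.coord i x a b • (U i).u a b := fun x => rfl
  have hunit : ∀ i a b, φ (c.unit i a b) = (U i).u a b := by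
    intro i a b
    rw [hφ, Finset.sum_eq_single i]
    · simp only [coord_unit_same, tracelessUnit, Matrix.sub_apply, sub_smul,
        Finset.sum_sub_distrib]
      have h1 : ∑ x, ∑ y, Matrix.single a b (1 : ℂ) x y • (U i).u x y = (U i).u a b := by
        rw [Finset.sum_eq_single a, Finset.sum_eq_single b]
        · simp
        · intro y _ hy
          simp [hy.symm]
        · simp
        · intro x _ hx
          simp [hx.symm]
        · simp
      -- The scalar correction maps to a multiple of the sum of the `c.D i x`, which is zero.
      have h2 : ∀ z : ℂ, ∑ x, ∑ y, (z • (1 : Matrix (Fin (n i + 1)) _ ℂ)) x y • (U i).u x y = 0 := by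
        intro z
        have h3 : ∀ x, ∑ y, (z • (1 : Matrix (Fin (n i + 1)) _ ℂ)) x y • (U i).u x y =
            z • (c.D i x : M) := by
          intro x
          rw [Finset.sum_eq_single x]
          · simp [(U i).u_self]
          · intro y _ hy
            simp [hy.symm]
          · simp
        simp_rw [h3, ← Finset.smul_sum]
        have h4 := congrArg (Subtype.val : t → M) (c.sum_D i)
        rw [AddSubmonoidClass.coe_finsetSum] at h4
        rw [h4, ZeroMemClass.coe_zero, smul_zero]
      rw [h1, h2, sub_zero]
    · intro l _ hl
      rw [c.coord_unit_of_ne hl]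
      simp
    · simp
  have hlie_unit : ∀ i a b l x y, φ ⁅c.unit i a b, c.unit l x y⁆ = ⁅(U i).u a b, (U l).u x y⁆ := by
    intro i a b l x y
    by_cases hil : i = l
    · subst hil
      rw [lie_unit, (U i).lie_u, map_sub]
      congr 1 <;> split_ifs <;> simp [hunit]
    · rw [c.lie_unit_of_ne hil, hR.lie_u_of_ne ht' hil, map_zero]
  have hlie : ∀ x y, φ ⁅x, y⁆ = ⁅φ x, φ y⁆ := by
    intro x y
    rw [← c.sum_coord_smul_unit x, ← c.sum_coord_smul_unit y]
    simp only [sum_lie, lie_sum, smul_lie, lie_smul, map_sum, map_smul, hlie_unit, hunit]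
  have hmem : ∀ x, φ x ∈ g' := fun x =>
    sum_mem fun i _ => sum_mem fun a _ => sum_mem fun b _ => g'.smul_mem _ ((U i).u_mem a b)
  have ht : ∀ h : t, φ ⟨h, c.le h.2⟩ = h := by
    intro h
    have h1 : (⟨h, c.le h.2⟩ : g) = ∑ i, ∑ a, c.ε i a h • c.unit i a a := by
      apply Subtype.ext
      conv_lhs => rw [← c.sum_ε_smul_D h]
      simp [coe_D]
    rw [h1]
    simp only [map_sum, map_smul, hunit, (U _).u_self]
    conv_rhs => rw [← c.sum_ε_smul_D h]
    simp
  let ψ : g →ₗ⁅ℂ⁆ g' :=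
    { toLinearMap := φ.codRestrict g'.toSubmodule hmem
      map_lie' := fun {x y} => Subtype.ext (hlie x y) }
  have hψ : ∀ x, (ψ x : M) = φ x := fun x => rfl
  have hinj : Function.Injective ψ := by
    rw [injective_iff_map_eq_zero]
    intro x hx
    have hx' : φ x = 0 := by rw [← hψ, hx]; rfl
    -- Bracketing twice with the unit at (b, a) isolates the entry at (a, b). So a kernel element is
    -- diagonal, hence in `t`, where φ is the identity.
    have hdiag : ∀ i, (c.coord i x).IsDiag := by
      intro i a b hab
      have h1 : ⁅c.unit i b a, ⁅x, c.unit i b a⁆⁆ = (2 * c.coord i x a b) • c.unit i b a := by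
        refine c.ext_coord fun l => ?_
        by_cases hl : l = i
        · subst hl
          rw [LieHom.map_lie, LieHom.map_lie, map_smul, coord_unit_same,
            single_lie_lie_single _ hab]
        · rw [LieHom.map_lie, map_smul, c.coord_unit_of_ne hl, zero_lie, smul_zero]
      have h2 := congrArg φ h1
      rw [hlie, hlie, hx', zero_lie, lie_zero, map_smul, hunit, eq_comm, smul_eq_zero] at h2
      simpa using h2.resolve_right ((U i).u_ne_zero hab.symm)
    have hxt := (c.mem_iff x).2 hdiag
    have h3 := ht ⟨x, hxt⟩
    exact Subtype.ext (h3.symm.trans hx')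
  have hsurj : Function.Surjective ψ := by
    -- The root spaces of `g'` are lines, each spanned by one of the units.
    have key := le_of_forall_weightVectors ht' (N := LinearMap.range φ)
      (fun h => ⟨_, ht h⟩) (fun α hα y hyg hy => by
        obtain ⟨i, a, b, hab, rfl⟩ := hR.exists_eq ht' hα
        obtain ⟨z, hz⟩ := exists_smul_eq_of_mem_rootSet ht' (c.root_ne_zero i hab)
          ((U i).u_mem a b) hyg ((U i).u_ne_zero hab) ((U i).u_mem_weightVectors a b) hy
        exact ⟨z • c.unit i a b, by rw [map_smul, hunit, hz]⟩)
    intro y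
    obtain ⟨x, hx⟩ := key y.2
    exact ⟨x, Subtype.ext hx⟩
  exact ⟨LieEquiv.ofBijective ψ ⟨hinj, hsurj⟩, ht⟩

end SLCoords

/-- A commuting family of semisimple endomorphisms over an algebraically closed field has a common
eigenbasis, which may be indexed by any type of the right size. -/
lemma exists_basis_forall_eq_smul {ι m W : Type*} [Fintype m] [AddCommGroup W] [Module ℂ W]
    [FiniteDimensional ℂ W] (b₀ : Module.Basis m ℂ W) (f : ι → Module.End ℂ W)
    (hss : ∀ i, (f i).IsSemisimple) (hcomm : ∀ i j, Commute (f i) (f j)) :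
    ∃ b : Module.Basis m ℂ W, ∀ a, ∃ μ : ι → ℂ, ∀ i, f i (b a) = μ i • b a := by
  classical
  have hmap : ∀ i j φ, Set.MapsTo (f i) ((f j).maxGenEigenspace φ) ((f j).maxGenEigenspace φ) :=
    fun i j φ => Module.End.mapsTo_maxGenEigenspace_of_comm (hcomm j i) φ
  have hind := Module.End.independent_iInf_maxGenEigenspace_of_forall_mapsTo f hmap
  have htop := Module.End.iSup_iInf_maxGenEigenspace_eq_top_of_forall_mapsTo f hmap
    fun i => Module.End.iSup_maxGenEigenspace_eq_top (f i)
  have hint := DirectSum.isInternal_submodule_of_iSupIndep_of_iSup_eq_top hind htop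
  let b₁ := hint.collectedBasis fun χ => Module.finBasis ℂ
    (⨅ i, (f i).maxGenEigenspace (χ i) : Submodule ℂ W)
  refine ⟨b₁.reindex (b₁.indexEquiv b₀), fun a => ⟨((b₁.indexEquiv b₀).symm a).1, fun i => ?_⟩⟩
  rw [Module.Basis.reindex_apply]
  have h1 := hint.collectedBasis_mem (fun χ => Module.finBasis ℂ
    (⨅ i, (f i).maxGenEigenspace (χ i) : Submodule ℂ W)) ((b₁.indexEquiv b₀).symm a)
  have h2 := (Submodule.mem_iInf _).1 h1 i
  rw [(hss i).isFinitelySemisimple.maxGenEigenspace_eq_eigenspace] at h2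
  exact Module.End.mem_eigenspace_iff.1 h2

/-! ### Making the Cartan subalgebra diagonal. -/

section Diagonalization

variable {M : Type*} [LieRing M] [LieAlgebra ℂ M] [FiniteDimensional ℂ M]
  {t g : LieSubalgebra ℂ M} [IsKilling ℂ g] {W : Type*} [AddCommGroup W] [Module ℂ W]
  {q : LieIdeal ℂ g} {ρ : g →ₗ⁅ℂ⁆ Module.End ℂ W}

/-- A Cartan subalgebra is its own centralizer, and ρ is faithful on the ideal, which contains ⁅h,
x⁆. -/
lemma mem_cartan_of_commute (ht : IsCartanIn t g) (hinj : ∀ x ∈ q, ρ x = 0 → x = 0)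
    {x : g} (hx : x ∈ q) (hc : ∀ h (hh : h ∈ t), Commute (ρ ⟨h, ht.1 hh⟩) (ρ x)) : (x : M) ∈ t := by
  refine mem_of_forall_lie_eq_zero ht x.2 fun h => ?_
  have h1 : ⁅(⟨h, ht.1 h.2⟩ : g), x⁆ = 0 := by
    refine hinj _ (lie_mem_right ℂ g q _ _ hx) ?_
    rw [LieHom.map_lie, ← commute_iff_lie_eq]
    exact hc h h.2
  exact congrArg (Subtype.val : g → M) h1

lemma commute_of_isCartanIn (ht : IsCartanIn t g) (h h' : t) :
    Commute (ρ ⟨h, ht.1 h.2⟩) (ρ ⟨h', ht.1 h'.2⟩) := by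
  have h1 : ⁅(⟨h, ht.1 h.2⟩ : g), (⟨h', ht.1 h'.2⟩ : g)⁆ = 0 :=
    Subtype.ext (lie_eq_zero_of_isCartanIn ht h h')
  rw [commute_iff_lie_eq, ← LieHom.map_lie, h1, map_zero]

variable [FiniteDimensional ℂ W]

/-- The nilpotent Jordan part N of ρ(h) is traceless, so N = ρ(x) with x in the ideal. As a
polynomial in ρ(h) it commutes with the image of `t`, so x lies in `t`; being ad-nilpotent, x
vanishes. -/
lemma isSemisimple_of_isCartanIn (ht : IsCartanIn t g) (hinj : ∀ x ∈ q, ρ x = 0 → x = 0)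
    (hsurj : ∀ A : Module.End ℂ W, LinearMap.trace ℂ W A = 0 → ∃ x ∈ q, ρ x = A) (h : t) :
    (ρ ⟨h, ht.1 h.2⟩).IsSemisimple := by
  obtain ⟨N, hN, S, -, hnil, hss, heq⟩ :=
    (ρ ⟨h, ht.1 h.2⟩).exists_isNilpotent_isSemisimple
  obtain ⟨x, hxq, hx⟩ := hsurj N (LinearMap.isNilpotent_trace_of_isNilpotent hnil).eq_zero
  have hxt : (x : M) ∈ t := by
    refine mem_cartan_of_commute ht hinj hxq fun h' hh' => ?_
    rw [hx]
    exact Algebra.commute_of_mem_adjoin_singleton_of_commute hN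
      (commute_of_isCartanIn ht ⟨h', hh'⟩ h)
  have hρ : ∀ (k : ℕ) (y : g), ρ (((ad ℂ g x) ^ k) y) =
      ((ad ℂ (Module.End ℂ W) N) ^ k) (ρ y) := by
    intro k y
    induction k with
    | zero => simp
    | succ k ih =>
      rw [pow_succ', Module.End.mul_apply, ad_apply, LieHom.map_lie, ih, hx, pow_succ',
        Module.End.mul_apply, ad_apply]
  have hcoe : ∀ (k : ℕ) (y : g), ((((ad ℂ g x) ^ k) y : g) : M) = ((ad ℂ M (x : M)) ^ k) y := by
    intro k y
    induction k with
    | zero => simp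
    | succ k ih =>
      rw [pow_succ', Module.End.mul_apply, ad_apply, LieSubalgebra.coe_bracket, ih, pow_succ',
        Module.End.mul_apply, ad_apply]
  obtain ⟨k, hk⟩ := LieAlgebra.ad_nilpotent_of_nilpotent (R := ℂ) hnil
  have h0 : (⟨x, hxt⟩ : t) = 0 := by
    refine eq_zero_of_isNilpotent_ad ht _ ⟨k + 1, fun y hy => ?_⟩
    have h1 : ((ad ℂ g x) ^ (k + 1)) ⟨y, hy⟩ = 0 := by
      refine hinj _ ?_ ?_
      · rw [pow_succ', Module.End.mul_apply, ad_apply]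
        exact lie_mem_left ℂ g q _ _ hxq
      · rw [hρ, pow_succ, hk, zero_mul, LinearMap.zero_apply]
    rw [← hcoe (k + 1) ⟨y, hy⟩, h1]
    rfl
  have hx0 : x = 0 := Subtype.ext (congrArg (Subtype.val : t → M) h0)
  rw [hx0, map_zero] at hx
  rw [heq, ← hx, zero_add]
  exact hss

/-- If `ρ` restricts to an isomorphism from an ideal onto the traceless endomorphisms, then in a
suitable basis the Cartan subalgebra corresponds to the diagonal matrices. -/
lemma exists_diagonal_form {m : Type*} [Fintype m] [DecidableEq m] (b₀ : Module.Basis m ℂ W)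
    (ht : IsCartanIn t g) (hinj : ∀ x ∈ q, ρ x = 0 → x = 0)
    (hsurj : ∀ A : Module.End ℂ W, LinearMap.trace ℂ W A = 0 → ∃ x ∈ q, ρ x = A)
    (htr : ∀ x, LinearMap.trace ℂ W (ρ x) = 0) :
    ∃ σ : g →ₗ⁅ℂ⁆ Matrix m m ℂ, (∀ x, (σ x).trace = 0) ∧
      (∀ A : Matrix m m ℂ, A.trace = 0 → ∃ x ∈ q, σ x = A) ∧ (∀ x, σ x = 0 ↔ ρ x = 0) ∧
      (∀ x : g, (x : M) ∈ t → (σ x).IsDiag) ∧ (∀ x ∈ q, (σ x).IsDiag → (x : M) ∈ t) := by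
  obtain ⟨b, hb⟩ := exists_basis_forall_eq_smul b₀ (fun h : t => ρ ⟨h, ht.1 h.2⟩)
    (isSemisimple_of_isCartanIn ht hinj hsurj) (commute_of_isCartanIn ht)
  let θ := LinearMap.toMatrixAlgEquiv b
  have hθtr : ∀ A, (θ A).trace = LinearMap.trace ℂ W A := fun A =>
    (LinearMap.trace_eq_matrix_trace ℂ b A).symm
  let σ : g →ₗ⁅ℂ⁆ Matrix m m ℂ := (θ.toLieEquiv : Module.End ℂ W →ₗ⁅ℂ⁆ Matrix m m ℂ).comp ρ
  have hσ : ∀ x, σ x = θ (ρ x) := fun x => rfl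
  have hdiag : ∀ x : g, (x : M) ∈ t → (σ x).IsDiag := by
    intro x hx i j hij
    obtain ⟨μ, hμ⟩ := hb j
    have h1 : ρ x (b j) = μ ⟨x, hx⟩ • b j := hμ ⟨x, hx⟩
    rw [hσ]
    simp only [θ]
    rw [LinearMap.toMatrixAlgEquiv_apply, h1, map_smul, Module.Basis.repr_self, Finsupp.smul_apply,
      Finsupp.single_eq_of_ne hij, smul_zero]
  refine ⟨σ, fun x => by rw [hσ, hθtr, htr], fun A hA => ?_, fun x => ?_, hdiag, ?_⟩
  · obtain ⟨x, hxq, hx⟩ := hsurj (θ.symm A) (by rw [← hθtr, AlgEquiv.apply_symm_apply, hA])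
    exact ⟨x, hxq, by rw [hσ, hx, AlgEquiv.apply_symm_apply]⟩
  · rw [hσ]
    exact EmbeddingLike.map_eq_zero_iff
  · intro x hxq hx
    refine mem_cartan_of_commute ht hinj hxq fun h hh => ?_
    have h1 := hdiag ⟨h, ht.1 hh⟩ hh
    have h2 : Commute (σ ⟨h, ht.1 hh⟩) (σ x) := by
      rw [← hx.diagonal_diag, ← h1.diagonal_diag]
      exact Matrix.commute_diagonal _ _
    have h3 := h2.map θ.symm
    simpa [hσ] using h3

end Diagonalization

/-! ### Simple factors of a semisimple Lie algebra. -/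

section SimpleFactors

variable {L : Type*} [LieRing L] [LieAlgebra ℂ L]

lemma SimpleFactor.isAtom (q : SimpleFactor L) : IsAtom q.1 := by
  have hs := q.2
  refine ⟨fun h => hs.non_abelian ?_, fun J hJ => ?_⟩
  · have : Subsingleton q.1 := by
      rw [h]
      infer_instance
    infer_instance
  · rcases hs.eq_bot_or_eq_top (J.comap q.1.incl) with h | h
    · rw [LieIdeal.comap_incl_eq_bot] at h
      exact h.eq_bot_of_ge hJ.le
    · rw [LieIdeal.comap_incl_eq_top] at h
      exact absurd h hJ.not_ge

lemma SimpleFactor.disjoint {q q' : SimpleFactor L} (h : q ≠ q') : Disjoint q.1 q'.1 :=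
  q.isAtom.disjoint_of_ne q'.isAtom fun h' => h (Subtype.ext h')

lemma SimpleFactor.lie_eq_zero {q q' : SimpleFactor L} (h : q ≠ q') {x y : L} (hx : x ∈ q.1)
    (hy : y ∈ q'.1) : ⁅x, y⁆ = 0 := by
  have h1 : ⁅x, y⁆ ∈ q.1 ⊓ q'.1 := ⟨lie_mem_left ℂ L q.1 _ _ hx, lie_mem_right ℂ L q'.1 _ _ hy⟩
  rwa [(SimpleFactor.disjoint h).eq_bot, LieSubmodule.mem_bot] at h1

lemma SimpleFactor.eq_zero_of_forall_lie_eq_zero (q : SimpleFactor L) {x : L} (hx : x ∈ q.1)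
    (h : ∀ y ∈ q.1, ⁅x, y⁆ = 0) : x = 0 := by
  have := q.2
  have h1 : (⟨x, hx⟩ : q.1) ∈ LieAlgebra.center ℂ q.1 := by
    rw [LieModule.mem_maxTrivSubmodule]
    intro y
    apply Subtype.ext
    change ⁅(y : L), x⁆ = 0
    rw [← lie_skew, h y y.2, neg_zero]
  rw [LieAlgebra.center_eq_bot, LieSubmodule.mem_bot] at h1
  exact congrArg Subtype.val h1

variable [IsSemisimple ℂ L]

lemma SimpleFactor.exists_sum_eq [Fintype (SimpleFactor L)] (x : L) :
    ∃ f : SimpleFactor L → L, (∀ q, f q ∈ q.1) ∧ ∑ q, f q = x := by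
  have h1 : ⨆ q : SimpleFactor L, q.1.toSubmodule = ⊤ := by
    rw [← LieSubmodule.iSup_toSubmodule, LieSubmodule.toSubmodule_eq_top, eq_top_iff,
      ← IsSemisimple.sSup_atoms_eq_top (R := ℂ) (L := L)]
    exact sSup_le fun I hI =>
      le_iSup (fun q : SimpleFactor L => q.1) ⟨I, IsSemisimple.isSimple_of_isAtom I hI⟩
  have hx : x ∈ ⨆ q : SimpleFactor L, q.1.toSubmodule := by
    rw [h1]
    trivial
  rw [Submodule.mem_iSup_iff_exists_finsupp] at hx
  obtain ⟨f, hf, rfl⟩ := hx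
  exact ⟨f, hf, (Finsupp.sum_fintype f (fun _ y => y) fun _ => rfl).symm⟩

instance SimpleFactor.finite [FiniteDimensional ℂ L] : Finite (SimpleFactor L) := by
  have h1 : Set.Finite {I : LieIdeal ℂ L | IsAtom I} :=
    WellFoundedGT.finite_of_sSupIndep IsSemisimple.sSupIndep_isAtom
  exact (h1.subset fun q hq => SimpleFactor.isAtom ⟨q, hq⟩).to_subtype

end SimpleFactors

section Projection

variable {L : Type*} [LieRing L] [LieAlgebra ℂ L] [FiniteDimensional ℂ L] [IsKilling ℂ L]

/-- An ideal of a Lie algebra with nondegenerate Killing form is a retract. -/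
lemma LieIdeal.exists_retraction (q : LieIdeal ℂ L) :
    ∃ π : L →ₗ⁅ℂ⁆ q, ∀ x : q, π x = x := by
  have hc : IsCompl q.toSubmodule (LieIdeal.killingCompl ℂ L q).toSubmodule :=
    LieSubmodule.isCompl_toSubmodule.2 q.isCompl_killingCompl
  have hcross : ∀ a ∈ q, ∀ b ∈ LieIdeal.killingCompl ℂ L q, ⁅a, b⁆ = 0 := by
    intro a ha b hb
    have h1 : ⁅a, b⁆ ∈ q ⊓ LieIdeal.killingCompl ℂ L q :=
      ⟨lie_mem_left ℂ L _ _ _ ha, lie_mem_right ℂ L _ _ _ hb⟩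
    rwa [q.isCompl_killingCompl.inf_eq_bot, LieSubmodule.mem_bot] at h1
  obtain ⟨p, hpl, hp0⟩ : ∃ p : L →ₗ[ℂ] q, (∀ x : q, p x = x) ∧
      ∀ x, p x = 0 ↔ x ∈ LieIdeal.killingCompl ℂ L q :=
    ⟨q.toSubmodule.projectionOnto _ hc, Submodule.projectionOnto_apply_left hc,
      fun x => Submodule.projectionOnto_apply_eq_zero_iff hc⟩
  have hp : ∀ x, ∃ b ∈ LieIdeal.killingCompl ℂ L q, x = (p x : L) + b := fun x =>
    ⟨x - p x, by rw [← hp0, map_sub, hpl, sub_self], by abel⟩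
  refine ⟨{ toLinearMap := p, map_lie' := fun {x y} => ?_ }, hpl⟩
  obtain ⟨b, hb, hx⟩ := hp x
  obtain ⟨b', hb', hy⟩ := hp y
  have h1 : ⁅x, y⁆ = ((⁅p x, p y⁆ : q) : L) + ⁅b, b'⁆ := by
    conv_lhs => rw [hx, hy]
    rw [add_lie, lie_add, lie_add, hcross _ (p x).2 _ hb', ← lie_skew b, hcross _ (p y).2 _ hb,
      neg_zero, add_zero, zero_add]
    rfl
  change p ⁅x, y⁆ = ⁅p x, p y⁆
  rw [h1, map_add, (hp0 ⁅b, b'⁆).2 (lie_mem_left ℂ L _ _ _ hb), add_zero, hpl]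

end Projection

/-! ### Existence of the coordinates. -/

section Coordinates

variable {M : Type*} [LieRing M] [LieAlgebra ℂ M] [FiniteDimensional ℂ M]
  {t g : LieSubalgebra ℂ M} [IsKilling ℂ g]

lemma SimpleFactor.exists_representation (q : SimpleFactor g) {n : ℕ} (hq : IsOfTypeA n q.1) :
    ∃ ρ : g →ₗ⁅ℂ⁆ Module.End ℂ (Fin (n + 1) → ℂ), (∀ x ∈ q.1, ρ x = 0 → x = 0) ∧
      (∀ A : Module.End ℂ (Fin (n + 1) → ℂ), LinearMap.trace ℂ _ A = 0 → ∃ x ∈ q.1, ρ x = A) ∧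
      (∀ x, LinearMap.trace ℂ _ (ρ x) = 0) := by
  obtain ⟨φ⟩ := hq
  obtain ⟨π, hπ⟩ := q.1.exists_retraction
  let θ := (Matrix.toLinAlgEquiv' : Matrix (Fin (n + 1)) (Fin (n + 1)) ℂ ≃ₐ[ℂ] _)
  have hθ : ∀ A, LinearMap.trace ℂ _ (θ A) = A.trace := fun A => Matrix.trace_toLin'_eq A
  let ρ : g →ₗ⁅ℂ⁆ Module.End ℂ (Fin (n + 1) → ℂ) :=
    (θ.toLieEquiv : Matrix (Fin (n + 1)) (Fin (n + 1)) ℂ →ₗ⁅ℂ⁆ _).comp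
      ((LieAlgebra.SpecialLinear.sl (Fin (n + 1)) ℂ).incl.comp
        ((φ : q.1 →ₗ⁅ℂ⁆ LieAlgebra.SpecialLinear.sl (Fin (n + 1)) ℂ).comp π))
  have hρ : ∀ x, ρ x = θ (φ (π x)) := fun x => rfl
  refine ⟨ρ, fun x hx h0 => ?_, fun A hA => ?_, fun x => ?_⟩
  · rw [hρ, EmbeddingLike.map_eq_zero_iff] at h0
    have h1 : φ (π x) = 0 := Subtype.ext h0
    rw [EmbeddingLike.map_eq_zero_iff, hπ ⟨x, hx⟩] at h1
    exact congrArg Subtype.val h1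
  · have h1 : θ.symm A ∈ LieAlgebra.SpecialLinear.sl (Fin (n + 1)) ℂ := by
      change (θ.symm A).trace = 0
      rw [← hθ, AlgEquiv.apply_symm_apply, hA]
    refine ⟨φ.symm ⟨_, h1⟩, (φ.symm ⟨_, h1⟩).2, ?_⟩
    rw [hρ, hπ, LieEquiv.apply_symm_apply, AlgEquiv.apply_symm_apply]
  · rw [hρ, hθ]
    exact (φ (π x)).2

/-- A semisimple Lie algebra of type `A` is coordinatised by a product of `sl`s in such a way that
a given Cartan subalgebra corresponds to the diagonal matrices. -/
lemma exists_slCoords [IsSemisimple ℂ g] (ht : IsCartanIn t g) (n : SimpleFactor g → ℕ)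
    (hn : ∀ q : SimpleFactor g, IsOfTypeA (n q) q.1) : Nonempty (SLCoords t g n) := by
  classical
  have := Fintype.ofFinite (SimpleFactor g)
  choose ρ hinj hsurj htr using fun q : SimpleFactor g => q.exists_representation (hn q)
  choose σ hσtr hσsurj hσ0 hσdiag hσmem using fun q : SimpleFactor g =>
    exists_diagonal_form (Pi.basisFun ℂ (Fin (n q + 1))) ht (hinj q) (hsurj q) (htr q)
  have hσinj : ∀ q, ∀ x ∈ q.1, σ q x = 0 → x = 0 := fun q x hx h0 =>
    hinj q x hx ((hσ0 q x).1 h0)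
  -- Some y in q has the same image as x. It centralizes q because x does, and a simple ideal has
  -- trivial centre.
  have hne : ∀ q q' : SimpleFactor g, q ≠ q' → ∀ x ∈ q'.1, σ q x = 0 := by
    intro q q' hqq x hx
    obtain ⟨y, hyq, hy⟩ := hσsurj q (σ q x) (hσtr q x)
    have hy0 : y = 0 := q.eq_zero_of_forall_lie_eq_zero hyq fun z hz => by
      refine hσinj q _ (lie_mem_left ℂ g q.1 _ _ hyq) ?_
      rw [LieHom.map_lie, hy, ← LieHom.map_lie, SimpleFactor.lie_eq_zero hqq.symm hx hz, map_zero]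
    rw [← hy, hy0, map_zero]
  have hsum : ∀ (f : SimpleFactor g → g), (∀ q, f q ∈ q.1) → ∀ q, σ q (∑ p, f p) = σ q (f q) := by
    intro f hf q
    rw [map_sum, Finset.sum_eq_single q]
    · exact fun p _ hp => hne q p hp.symm _ (hf p)
    · simp
  refine ⟨⟨ht.1, σ, hσtr, fun A hA => ?_, fun x hx => ?_, fun x => ⟨fun h q => hσdiag q x h,
    fun h => ?_⟩⟩⟩
  · choose f hf hfA using fun q => hσsurj q (A q) (hA q)
    exact ⟨∑ q, f q, fun q => by rw [hsum f hf, hfA]⟩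
  · obtain ⟨f, hf, rfl⟩ := SimpleFactor.exists_sum_eq x
    exact Finset.sum_eq_zero fun q _ => hσinj q _ (hf q) (by rw [← hsum f hf, hx])
  · obtain ⟨f, hf, rfl⟩ := SimpleFactor.exists_sum_eq x
    rw [AddSubmonoidClass.coe_finsetSum]
    exact sum_mem fun q _ => hσmem q _ (hf q) (by rw [← hsum f hf]; exact h q)

end Coordinates

/-! ### Transport of simple factors and roots along an isomorphism. -/

section Transport

variable {L L' : Type*} [LieRing L] [LieAlgebra ℂ L] [LieRing L'] [LieAlgebra ℂ L']

lemma LieAlgebra.IsSimple.of_lieEquiv (ψ : L ≃ₗ⁅ℂ⁆ L') (h : IsSimple ℂ L) : IsSimple ℂ L' where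
  eq_bot_or_eq_top I := by
    rcases h.eq_bot_or_eq_top (I.comap (ψ : L →ₗ⁅ℂ⁆ L')) with h1 | h1
    · left
      rw [eq_bot_iff]
      intro x hx
      have h2 : ψ.symm x ∈ I.comap (ψ : L →ₗ⁅ℂ⁆ L') := by
        rw [LieIdeal.mem_comap]
        simpa using hx
      rw [h1, LieSubmodule.mem_bot] at h2
      rw [LieSubmodule.mem_bot]
      simpa using h2
    · right
      rw [eq_top_iff]
      intro x _
      have h2 : ψ.symm x ∈ I.comap (ψ : L →ₗ⁅ℂ⁆ L') := by
        rw [h1]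
        trivial
      rw [LieIdeal.mem_comap] at h2
      simpa using h2
  non_abelian hab := h.non_abelian <| by
    refine ⟨fun x y => ψ.injective ?_⟩
    change ψ ⁅x, y⁆ = ψ 0
    rw [LieEquiv.map_lie, LieModule.IsTrivial.trivial, map_zero]

/-- An isomorphism of Lie algebras restricts to the preimage of an ideal. -/
def LieIdeal.comapSymmEquiv (ψ : L ≃ₗ⁅ℂ⁆ L') (q : LieIdeal ℂ L) :
    q ≃ₗ⁅ℂ⁆ q.comap (ψ.symm : L' →ₗ⁅ℂ⁆ L) where
  toFun x := ⟨ψ x, by rw [LieIdeal.mem_comap]; simp⟩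
  invFun y := ⟨ψ.symm y, y.2⟩
  map_add' x y := Subtype.ext (map_add ψ _ _)
  map_smul' c x := Subtype.ext (map_smul ψ c _)
  map_lie' {x y} := Subtype.ext (LieEquiv.map_lie ψ _ _)
  left_inv x := Subtype.ext (ψ.symm_apply_apply _)
  right_inv y := Subtype.ext (ψ.apply_symm_apply _)

/-- An isomorphism of Lie algebras induces a bijection of simple factors. -/
def SimpleFactor.equivOfLieEquiv (ψ : L ≃ₗ⁅ℂ⁆ L') : SimpleFactor L ≃ SimpleFactor L' where
  toFun q := ⟨q.1.comap (ψ.symm : L' →ₗ⁅ℂ⁆ L), q.2.of_lieEquiv (LieIdeal.comapSymmEquiv ψ q.1)⟩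
  invFun q := ⟨q.1.comap (ψ : L →ₗ⁅ℂ⁆ L'), q.2.of_lieEquiv (LieIdeal.comapSymmEquiv ψ.symm q.1)⟩
  left_inv q := by
    apply Subtype.ext
    ext x
    simp [LieIdeal.mem_comap]
  right_inv q := by
    apply Subtype.ext
    ext x
    simp [LieIdeal.mem_comap]

end Transport

/-- sl_1 is zero, hence not simple. This removes n = 0, which the excluded set in the theorem does
not contain. -/
lemma IsOfTypeA.ne_zero {L : Type*} [LieRing L] [LieAlgebra ℂ L] (hL : IsSimple ℂ L) {n : ℕ}
    (h : IsOfTypeA n L) : n ≠ 0 := by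
  rintro rfl
  obtain ⟨φ⟩ := h
  have h1 : ∀ A : SpecialLinear.sl (Fin 1) ℂ, A = 0 := fun A => by
    have h2 : (A : Matrix (Fin 1) (Fin 1) ℂ).trace = 0 := A.2
    apply Subtype.ext
    ext i j
    rw [Matrix.trace_fin_one] at h2
    rw [Subsingleton.elim i 0, Subsingleton.elim j 0, h2]
    rfl
  refine hL.non_abelian ⟨fun x y => φ.injective ?_⟩
  exact (h1 _).trans (h1 _).symm

lemma rootsOf_subset_of_lieEquiv {M : Type*} [LieRing M] [LieAlgebra ℂ M] {t g g' : LieSubalgebra ℂ M}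
    (ht : t ≤ g) {q : LieIdeal ℂ g} {q' : LieIdeal ℂ g'} (ψ : g ≃ₗ⁅ℂ⁆ g')
    (hψ : ∀ h : t, (ψ ⟨h, ht h.2⟩ : M) = h) (hq : ∀ x ∈ q, ψ x ∈ q') :
    rootsOf t q ⊆ rootsOf t q' := by
  rintro α ⟨hα, x, hx, hx0, h⟩
  refine ⟨hα, ψ x, hq x hx, fun h0 => hx0 ?_, fun y => ?_⟩
  · rwa [EmbeddingLike.map_eq_zero_iff] at h0
  · have h1 : ⁅(⟨y, ht y.2⟩ : g), x⁆ = α y • x := Subtype.ext (h y)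
    have h2 := congrArg (fun z => ((ψ z : g') : M)) h1
    simp only [LieEquiv.map_lie, map_smul, LieSubalgebra.coe_bracket, hψ] at h2
    exact h2

theorem proposition3p2 (k : ℕ)
    (g g' t : LieSubalgebra ℂ (Module.End ℂ (Fin k → ℂ)))
    (hg : LieAlgebra.IsSemisimple ℂ g) (hg' : LieAlgebra.IsSemisimple ℂ g')
    (ht : IsCartanIn t g) (ht' : IsCartanIn t g')
    (hA : ∀ q : SimpleFactor g, ∃ n : ℕ, n ∉ ({1, 2, 3, 5, 7, 8} : Set ℕ) ∧ IsOfTypeA n q.1)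
    (hA4 : ∀ q₁ q₂ : SimpleFactor g, IsOfTypeA 4 q₁.1 → IsOfTypeA 4 q₂.1 → q₁ = q₂) :
    Nonempty (g ≃ₗ⁅ℂ⁆ g') ∧
      ∃ e : SimpleFactor g ≃ SimpleFactor g', ∀ q : SimpleFactor g,
        Nonempty (q.1 ≃ₗ⁅ℂ⁆ (e q).1) ∧ rootsOf t q.1 = rootsOf t (e q).1 := by
  classical
  have : Fintype (SimpleFactor g) := Fintype.ofFinite _
  have : IsKilling ℂ g := inferInstance
  have : IsKilling ℂ g' := inferInstance
  choose n hn hn' using hA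
  obtain ⟨c⟩ := exists_slCoords ht n hn'
  have : IsLieAbelian t := ⟨fun x y => Subtype.ext (lie_eq_zero_of_isCartanIn ht' x y)⟩
  -- An element with all weights zero is nilpotent, hence ad-nilpotent, so it is zero in a Cartan
  -- subalgebra of a semisimple algebra.
  have hnil : ∀ h : t, (∀ χ : Weight ℂ t (Fin k → ℂ), χ h = 0) → h = 0 := fun h hh => by
    obtain ⟨m, hm⟩ := LieAlgebra.ad_nilpotent_of_nilpotent (R := ℂ)
      (isNilpotent_of_forall_weight_eq_zero hh)
    exact eq_zero_of_isNilpotent_ad ht' h ⟨m, fun x _ => by rw [hm, LinearMap.zero_apply]⟩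
  have hR : c.RootsLE g' := fun α _ H e f T he =>
    c.exists_eq_sub hnil
      (fun q hq => by
        rcases hq with hq | hq
        · exact (hn' q).ne_zero q.2 hq
        · exact hn q hq)
      (fun q₁ q₂ h₁ h₂ => hA4 q₁ q₂ (h₁ ▸ hn' q₁) (h₂ ▸ hn' q₂)) T he
  obtain ⟨ψ, hψ⟩ := hR.exists_lieEquiv ht'
  have hψ' : ∀ h : t, (ψ.symm ⟨h, ht'.1 h.2⟩ : Module.End ℂ (Fin k → ℂ)) = h := fun h => by
    have h1 : ψ ⟨h, ht.1 h.2⟩ = ⟨h, ht'.1 h.2⟩ := Subtype.ext (hψ h)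
    rw [← h1, ψ.symm_apply_apply]
  refine ⟨⟨ψ⟩, SimpleFactor.equivOfLieEquiv ψ, fun q => ⟨⟨LieIdeal.comapSymmEquiv ψ q.1⟩,
    Set.Subset.antisymm (rootsOf_subset_of_lieEquiv ht.1 ψ hψ fun x hx => ?_)
      (rootsOf_subset_of_lieEquiv ht'.1 ψ.symm hψ' fun x hx => hx)⟩⟩
  exact (LieIdeal.comapSymmEquiv ψ q.1 ⟨x, hx⟩).2
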